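/- Let $n\ge 3$, let $M$ be a smooth $n$-manifold with a Riemannian metric $g$, and let $\gamma=(\gamma(r))_{r\in\mathbb R}$ be a family of $(1,1)$-tensor fields on $M$, smooth jointly in $r$ and the point of $M$, such that each $\gamma(r)$ is $g$-self-adjoint, $\gamma(0)=\mathrm{Id}$, and, for some fixed $\delta>0$, $\gamma(r)$ is nonsingular for $|r|<\delta$. Assume the normalization $g(\dot\gamma(0)(\cdot),\cdot)=2P^g$, where $P^g=\frac{1}{n-2}\big(\mathrm{Ric}^g-\frac{S^g}{2(n-1)}g\big)$ is the Schouten tensor of $g$. Let $$\widetilde M=\mathbb R_{>0}\times(-\delta,\delta)\times M,\qquad \widetilde g=d(rt)\otimes dt+dt\otimes d(rt)+t^2 g(\gamma(r)(\cdot),\cdot),$$ with coordinates $(t,r)$ on the first two factors. For a smooth function $u$ on $M$ (for instance $u=0$) let $\Psi\colon M\to\widetilde M$, $\Psi(x)=(e^{u(x)},0,x)$, a codimension two spacelike immersion into a Lorentzian manifold. The pullback bundle $\Psi^*(T\widetilde M)$, with the line subbundle spanned by $\xi=e^u\partial_t|_\Psi$, the bundle metric induced by $\widetilde g$, and the connection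 $\widetilde\nabla$ induced by the Levi-Civita connection of $\widetilde g$, is the normal conformal tractor bundle of $(M,[g])$. Let $W$ be a smooth section of $\Psi^*(T\widetilde M)$, and write $W=T\Psi\cdot W^\top+W^\perp$ with $W^\top$ a vector field on $M$ and $W^\perp$ normal to $\Psi$. Then $W$ is parallel, that is, $\widetilde\nabla_VW=0$ for every smooth vector field $V$ on $M$, if and only if $$\nabla_VW^\top=A_{W^\perp}V\qquad\text{and}\qquad \mathrm{II}(V,W^\top)+\nabla^\perp_VW^\perp=0$$ for every smooth vector field $V$ on $M$. Here $\nabla$ is the Levi-Civita connection of the induced metric $\Psi^*\widetilde g$, $\mathrm{II}(V,U)=(\widetilde\nabla_V(T\Psi\cdot U))^\perp$ is the second fundamental form of $\Psi$, $A_\zeta V=-(\widetilde\nabla_V\zeta)^\top$ is the Weingarten endomorphism of a normal field $\zeta$, and $\nabla^\perp_V\zeta=(\widetilde\nabla_V\zeta)^\perp$ is the normal connection. -/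

import Mathlib

open scoped Manifold ContDiff Topology
open Bundle

noncomputable section

namespace TractorImmersion

section General

variable {E : Type*} [NormedAddCommGroup E] [NormedSpace ℝ E]
  {H : Type*} [TopologicalSpace H] {I : ModelWithCorners ℝ E H}
  {M : Type*} [TopologicalSpace M] [ChartedSpace H M] [IsManifold I ∞ M]
  {E' : Type*} [NormedAddCommGroup E'] [NormedSpace ℝ E']
  {H' : Type*} [TopologicalSpace H'] {I' : ModelWithCorners ℝ E' H'}
  {M' : Type*} [TopologicalSpace M'] [ChartedSpace H' M'] [IsManifold I' ∞ M']

/-- A field of real valued functions of two tangent vectors; the definitions below are applied to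
(possibly indefinite) metric tensors. -/
abbrev MetricField (I : ModelWithCorners ℝ E H) (M : Type*) [TopologicalSpace M]
    [ChartedSpace H M] :=
  Π x : M, TangentSpace I x → TangentSpace I x → ℝ

/-- `V` is a smooth vector field on `M`. -/
def IsSmoothField (V : Π x : M, TangentSpace I x) : Prop :=
  ContMDiff I I.tangent ∞ (fun x ↦ (⟨x, V x⟩ : TangentBundle I M))

variable (I) in
/-- `W` is a smooth vector field along `Ψ`, that is, a smooth section of the pullback bundle
`Ψ^* TM'`. -/
def IsSmoothFieldAlong (Ψ : M → M')
    (W : Π x : M, TangentSpace I' (Ψ x)) : Prop :=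
  ContMDiff I I'.tangent ∞ (fun x ↦ (⟨Ψ x, W x⟩ : TangentBundle I' M'))

/-! ### Levi-Civita connection, induced connection, curvature -/

/-- The tangent vector `a` at `x` with `g(a, z) = α(z)` for all `z` (unique when `g` is
nondegenerate at `x` and `α` is linear). -/
def raise (g : MetricField I M) (x : M) (α : TangentSpace I x → ℝ) : TangentSpace I x :=
  Classical.epsilon fun a ↦ ∀ z, g x a z = α z

/-- The Christoffel term `Γ(u, w)` of `g` at `x` in the preferred chart at `x`: the value at `x` of
`∇_û ŵ`, where `û`, `ŵ`, `ẑ` denote the fields around `x` with constant components in this chart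
that extend `u`, `w`, `z`. It is given by the Koszul formula
`2 g(Γ(u, w), z) = u (g(ŵ, ẑ)) + w (g(û, ẑ)) - z (g(û, ŵ))`,
in which no brackets occur since `û`, `ŵ`, `ẑ` commute. -/
def christoffel (g : MetricField I M) (x : M) (u w : TangentSpace I x) : TangentSpace I x :=
  raise g x fun z ↦
    (mvfderiv I (fun y ↦ g y (FiberBundle.extend E w y) (FiberBundle.extend E z y)) x u
      + mvfderiv I (fun y ↦ g y (FiberBundle.extend E u y) (FiberBundle.extend E z y)) x w
      - mvfderiv I (fun y ↦ g y (FiberBundle.extend E u y) (FiberBundle.extend E w y)) x z) / 2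

/-- The derivative in the direction `v` at `x` of the components of a vector field `W` along `Ψ`,
with respect to the coordinate frame of the preferred chart at `Ψ x`. -/
def componentDeriv (Ψ : M → M') (W : Π x : M, TangentSpace I' (Ψ x)) (x : M)
    (v : TangentSpace I x) : TangentSpace I' (Ψ x) :=
  (trivializationAt E' (TangentSpace I' : M' → Type _) (Ψ x)).symm (Ψ x)
    (mvfderiv I (fun y ↦ (trivializationAt E' (TangentSpace I' : M' → Type _) (Ψ x)
      (⟨Ψ y, W y⟩ : TangentBundle I' M')).2) x v)

/-- The covariant derivative `∇_v W` of a vector field `W` on `M` for the Levi-Civita connection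
of `g`; in coordinates, `(∇_v W)^k = v(W^k) + Γ^k_{ij} v^i W^j`. -/
def leviCivita (g : MetricField I M) (W : Π x : M, TangentSpace I x) (x : M)
    (v : TangentSpace I x) : TangentSpace I x :=
  componentDeriv (I := I) (I' := I) (fun y : M ↦ y) W x v + christoffel g x v (W x)

/-- The connection induced along `Ψ : M → M'` (that is, on `Ψ^* TM'`) by the Levi-Civita connection
of the metric `g'` on `M'`; in coordinates,
`(∇̃_v W)^k = v(W^k) + (Γ^k_{ij} ∘ Ψ) (TΨ v)^i W^j`. -/
def inducedConnection (g' : MetricField I' M') (Ψ : M → M')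
    (W : Π x : M, TangentSpace I' (Ψ x)) (x : M) (v : TangentSpace I x) :
    TangentSpace I' (Ψ x) :=
  componentDeriv Ψ W x v + christoffel g' (Ψ x) (mfderiv I I' Ψ x v) (W x)

/-- The curvature `R(X, Y) Z = ∇_X ∇_Y Z - ∇_Y ∇_X Z - ∇_[X, Y] Z` of `g`. -/
def curvature (g : MetricField I M) (X Y Z : Π x : M, TangentSpace I x) (x : M) :
    TangentSpace I x :=
  leviCivita g (fun y ↦ leviCivita g Z y (Y y)) x (X x)
    - leviCivita g (fun y ↦ leviCivita g Z y (X y)) x (Y x)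
    - leviCivita g Z x (VectorField.mlieBracket I X Y x)

/-- The trace of an endomorphism of the tangent space at `x`. -/
def tangentTrace [FiniteDimensional ℝ E] (x : M) (T : TangentSpace I x → TangentSpace I x) : ℝ :=
  ∑ i, (Module.finBasis ℝ E).repr (T (Module.finBasis ℝ E i)) i

/-- The Ricci tensor `Ric(v, w) = trace (z ↦ R(z, v) w)`. -/
def ricci [FiniteDimensional ℝ E] (g : MetricField I M) : MetricField I M := fun x v w ↦
  tangentTrace x fun z ↦ curvature g (FiberBundle.extend E z) (FiberBundle.extend E v)
    (FiberBundle.extend E w) x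

/-- The scalar curvature, the trace of the Ricci tensor with respect to `g`. -/
def scalarCurvature [FiniteDimensional ℝ E] (g : MetricField I M) (x : M) : ℝ :=
  tangentTrace x fun v ↦ raise g x fun z ↦ ricci g x v z

/-- The Schouten tensor `P = (Ric - S / (2 (n - 1)) g) / (n - 2)`, with `n = dim M`. -/
def schouten [FiniteDimensional ℝ E] (g : MetricField I M) : MetricField I M := fun x v w ↦
  (ricci g x v w - scalarCurvature g x / (2 * ((Module.finrank ℝ E : ℝ) - 1)) * g x v w)
    / ((Module.finrank ℝ E : ℝ) - 2)

/-! ### Submanifold theory of an immersion `Ψ : M → (M', g')` -/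

variable (I) in
/-- The induced metric `Ψ^* g'`. -/
def inducedMetric (g' : MetricField I' M') (Ψ : M → M') : MetricField I M := fun x v w ↦
  g' (Ψ x) (mfderiv I I' Ψ x v) (mfderiv I I' Ψ x w)

variable (I') in
/-- The vector field `TΨ · U` along `Ψ`. -/
def pushField (Ψ : M → M') (U : Π x : M, TangentSpace I x) (x : M) : TangentSpace I' (Ψ x) :=
  mfderiv I I' Ψ x (U x)

variable (I) in
/-- The tangent part `W^⊤` of a vector field `W` along `Ψ`: at each `x`, the vector in `T_x M` such
that `W - TΨ · W^⊤` is orthogonal to `TΨ · T_x M`. -/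
def tangentPart (g' : MetricField I' M') (Ψ : M → M')
    (W : Π x : M, TangentSpace I' (Ψ x)) (x : M) : TangentSpace I x :=
  Classical.epsilon fun a : TangentSpace I x ↦
    ∀ v : TangentSpace I x, g' (Ψ x) (W x - mfderiv I I' Ψ x a) (mfderiv I I' Ψ x v) = 0

variable (I) in
/-- The normal part `W^⊥ = W - TΨ · W^⊤` of a vector field `W` along `Ψ`. -/
def normalPart (g' : MetricField I' M') (Ψ : M → M')
    (W : Π x : M, TangentSpace I' (Ψ x)) (x : M) : TangentSpace I' (Ψ x) :=
  W x - mfderiv I I' Ψ x (tangentPart I g' Ψ W x)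

/-- The second fundamental form, `II(V, U) = (∇̃_V (TΨ · U))^⊥`. -/
def secondFundamentalForm (g' : MetricField I' M') (Ψ : M → M')
    (V U : Π x : M, TangentSpace I x) : Π x : M, TangentSpace I' (Ψ x) :=
  normalPart I g' Ψ fun x ↦ inducedConnection g' Ψ (pushField I' Ψ U) x (V x)

/-- The Weingarten endomorphism of a normal field `ζ`, `A_ζ V = -(∇̃_V ζ)^⊤`. -/
def weingarten (g' : MetricField I' M') (Ψ : M → M') (ζ : Π x : M, TangentSpace I' (Ψ x))
    (V : Π x : M, TangentSpace I x) : Π x : M, TangentSpace I x :=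
  fun x ↦ -tangentPart I g' Ψ (fun y ↦ inducedConnection g' Ψ ζ y (V y)) x

/-- The normal connection, `∇^⊥_V ζ = (∇̃_V ζ)^⊥`. -/
def normalConnection (g' : MetricField I' M') (Ψ : M → M') (V : Π x : M, TangentSpace I x)
    (ζ : Π x : M, TangentSpace I' (Ψ x)) : Π x : M, TangentSpace I' (Ψ x) :=
  normalPart I g' Ψ fun x ↦ inducedConnection g' Ψ ζ x (V x)

/-! ### The Lorentzian ambient space -/

/-- The open set `B = ℝ_{>0} × (-δ, δ)` of `ℝ × ℝ`, with coordinates `(t, r)`. -/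
def ambientBase (δ : ℝ) : TopologicalSpace.Opens (ℝ × ℝ) :=
  ⟨Set.Ioi 0 ×ˢ Set.Ioo (-δ) δ, isOpen_Ioi.prod isOpen_Ioo⟩

/-- The manifold `M̃ = B × M`. -/
abbrev Ambient (δ : ℝ) (M : Type*) := ambientBase δ × M

/-- The model with corners of `M̃ = B × M`. -/
abbrev ambientModel (I : ModelWithCorners ℝ E H) :
    ModelWithCorners ℝ ((ℝ × ℝ) × E) (ModelProd (ℝ × ℝ) H) :=
  (𝓘(ℝ, ℝ × ℝ)).prod I

/-- A one-parameter family of `(1, 1)`-tensor fields on `M`. -/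
abbrev TensorFamily (I : ModelWithCorners ℝ E H) (M : Type*) [TopologicalSpace M]
    [ChartedSpace H M] :=
  ℝ → Π x : M, TangentSpace I x →L[ℝ] TangentSpace I x

/-- `γ` is an admissible family: it is smooth (jointly in `r` and `x`), every `γ(r)` is self-adjoint
for `g` (equivalently, for every metric conformal to `g`), `γ(0) = Id`, and `γ(r)` is nonsingular
for `|r| < δ`, where `δ > 0`. -/
structure IsAdmissible (g : MetricField I M) (γ : TensorFamily I M) (δ : ℝ) : Prop where
  smooth : ContMDiff ((𝓘(ℝ, ℝ)).prod I) (I.prod 𝓘(ℝ, E →L[ℝ] E)) ∞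
    (fun p : ℝ × M ↦ (TotalSpace.mk' (E →L[ℝ] E) p.2 (γ p.1 p.2) :
      TotalSpace (E →L[ℝ] E) fun x : M ↦ TangentSpace I x →L[ℝ] TangentSpace I x))
  selfAdjoint : ∀ (r : ℝ) (x : M) (v w : TangentSpace I x), g x (γ r x v) w = g x v (γ r x w)
  at_zero : ∀ x : M, γ 0 x = ContinuousLinearMap.id ℝ (TangentSpace I x)
  pos : 0 < δ
  nonsingular : ∀ r : ℝ, |r| < δ → ∀ x : M, Function.Bijective (γ r x)

/-- The derivative `γ̇(0)`, given by `γ̇(0)(v) = d/dr γ(r)(v)` at `r = 0`. -/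
def gammaDot (γ : TensorFamily I M) (x : M) (v : TangentSpace I x) : TangentSpace I x :=
  deriv (F := E) (fun r : ℝ ↦ γ r x v) 0

/-- The normalization condition `g(γ̇(0)(-), -) = 2 P^g` (for `dim M ≥ 3`), under which the tractor
bundle obtained from `γ` is the normal conformal tractor bundle. -/
def IsNormalized [FiniteDimensional ℝ E] (g : MetricField I M) (γ : TensorFamily I M) : Prop :=
  ∀ (x : M) (v w : TangentSpace I x), g x (gammaDot γ x v) w = 2 * schouten g x v w

/-- The Lorentzian metric `d(rt) ⊗ dt + dt ⊗ d(rt) + t² g(γ(r) -, -)` on `M̃ = B × M`. -/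
def ambientMetric (g : MetricField I M) (γ : TensorFamily I M) (δ : ℝ) :
    MetricField (ambientModel I) (Ambient δ M) := fun p a b ↦
  let dt := mvfderiv (ambientModel I) (fun q : Ambient δ M ↦ q.1.1.1) p
  let drt := mvfderiv (ambientModel I) (fun q : Ambient δ M ↦ q.1.1.2 * q.1.1.1) p
  let dπ := mfderiv (ambientModel I) I (fun q : Ambient δ M ↦ q.2) p
  drt a * dt b + dt a * drt b + p.1.1.1 ^ 2 * g p.2 (γ p.1.1.2 p.2 (dπ a)) (dπ b)

/-- The immersion `Ψ^u : M → M̃`, `x ↦ (e^{u(x)}, 0, x)`. -/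
def immersion {δ : ℝ} (hδ : 0 < δ) (u : M → ℝ) (x : M) : Ambient δ M :=
  (⟨(Real.exp (u x), 0), Real.exp_pos _, neg_lt_zero.mpr hδ, hδ⟩, x)

end General

end TractorImmersion

end

open scoped Manifold ContDiff Topology
open Bundle

noncomputable section

namespace TractorImmersion

section General

variable {E : Type*} [NormedAddCommGroup E] [NormedSpace ℝ E]
  {H : Type*} [TopologicalSpace H] {I : ModelWithCorners ℝ E H}
  {M : Type*} [TopologicalSpace M] [ChartedSpace H M] [IsManifold I ∞ M]
  {E' : Type*} [NormedAddCommGroup E'] [NormedSpace ℝ E']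
  {H' : Type*} [TopologicalSpace H'] {I' : ModelWithCorners ℝ E' H'}
  {M' : Type*} [TopologicalSpace M'] [ChartedSpace H' M'] [IsManifold I' ∞ M']

set_option linter.unusedSectionVars false
set_option synthInstance.maxHeartbeats 400000

/-! ### Tangent vectors, derivatives and fields in the preferred charts -/

/-! Split `W` as `TΨ · W^⊤ + W^⊥` and differentiate. The tangent part of `∇̃_V W` is `∇_V W^⊤ -
A_{W^⊥} V`, and its normal part is `II(V, W^⊤) + ∇^⊥_V W^⊥`. When the induced metric is
nondegenerate the splitting is direct, so `∇̃_V W` vanishes exactly when both parts do. The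
equivalence thus holds separately for each `V` and at each point.

The geometric input is `gauss_formula`: the tangent part of `∇̃_V (TΨ · U)` is the Levi-Civita
derivative of `U` for the induced metric. It rests on `koszul_pullbackForm`, which compares the
Koszul expression of a pulled back metric with that of the original one; the discrepancy is the
second derivative of the map.

The analytic input concerns objects defined by choice. `christoffel` and `tangentPart` are values of
`Classical.epsilon`, so their defining equations hold only after a solution is shown to exist;
nondegeneracy and finite dimension give this. Differentiating `W^⊤` also needs regularity, which
`differentiableAt_tangentPart` obtains by writing `W^⊤` in a chart as the inverse Gram form applied
to differentiable data. These steps combine in `inducedConnection_eq_zero_iff`, for a general map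
`Ψ` into a manifold with a metric.

For the ambient space it remains to check the hypotheses along `r = 0`. There `γ(0) = Id`, and the
metric is a hyperbolic plane in `(t, r)` plus `e^{2u} g`; the induced metric is `e^{2u} g`, which is
positive definite. -/

/-- The components of tangent vectors at `y` in the preferred chart at `x`. -/
def components (I : ModelWithCorners ℝ E H) {M : Type*} [TopologicalSpace M] [ChartedSpace H M]
    [IsManifold I ∞ M] (x y : M) : TangentSpace I y →L[ℝ] E :=
  (trivializationAt E (TangentSpace I : M → Type _) x).continuousLinearMapAt ℝ y

theorem components_apply {x y : M} (hy : y ∈ (chartAt H x).source) (v : TangentSpace I y) :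
    components I x y v =
      (trivializationAt E (TangentSpace I : M → Type _) x ⟨y, v⟩).2 := by
  rw [components, Trivialization.continuousLinearMapAt_apply, Trivialization.linearMapAt_apply]
  exact if_pos hy

theorem components_eq_mfderiv {x y : M} (hy : y ∈ (chartAt H x).source) :
    components I x y = mfderiv I 𝓘(ℝ, E) (extChartAt I x) y :=
  TangentBundle.continuousLinearMapAt_trivializationAt hy

theorem components_self (x : M) (v : TangentSpace I x) : components I x x v = v := by
  rw [components_apply (mem_chart_source H x), TangentBundle.trivializationAt_apply]
  exact tangentCoordChange_self (I := I) (mem_extChartAt_source x)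

theorem components_symm {x y : M} (hy : y ∈ (chartAt H x).source) (a : E) :
    components I x y ((trivializationAt E (TangentSpace I : M → Type _) x).symm y a) = a := by
  rw [components_apply hy]
  exact congrArg Prod.snd
    ((trivializationAt E (TangentSpace I : M → Type _) x).apply_mk_symm hy a)

theorem components_injective {x y : M} (hy : y ∈ (chartAt H x).source) {v w : TangentSpace I y}
    (h : components I x y v = components I x y w) : v = w := by
  rw [components_apply hy, components_apply hy] at h
  have := congrArg ((trivializationAt E (TangentSpace I : M → Type _) x).symm y) h
  rwa [Trivialization.symm_apply_apply_mk _ hy, Trivialization.symm_apply_apply_mk _ hy] at this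

/-- Extended vectors have constant components in the chart, so differentiating a metric on them
differentiates only its coefficients. This turns `christoffel` into a coordinate expression. -/
theorem components_extend {x y : M} (hy : y ∈ (chartAt H x).source) (v : TangentSpace I x) :
    components I x y (FiberBundle.extend E v y) = v := by
  rw [FiberBundle.extend, components_symm hy, ← components_apply (mem_chart_source H x),
    components_self]

theorem symm_self (x : M) (a : E) :
    (trivializationAt E (TangentSpace I : M → Type _) x).symm x a = a :=
  components_injective (mem_chart_source H x)
    (by rw [components_symm (mem_chart_source H x)]; exact (components_self (I := I) x a).symm)

theorem eventually_mem_chart_source (x : M) : ∀ᶠ y in 𝓝 x, y ∈ (chartAt H x).source :=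
  (chartAt H x).open_source.mem_nhds (mem_chart_source H x)

/-! ### Manifold derivatives as Fréchet derivatives in charts -/

section Boundaryless

variable [I.Boundaryless] [I'.Boundaryless]

theorem tendsto_extChartAt_symm (x : M) :
    Filter.Tendsto (extChartAt I x).symm (𝓝 (extChartAt I x x)) (𝓝 x) := by
  have := continuousAt_extChartAt_symm (I := I) x
  rwa [ContinuousAt, extChartAt_to_inv] at this

theorem eventually_symm {x : M} {P : M → Prop} (h : ∀ᶠ y in 𝓝 x, P y) :
    ∀ᶠ e in 𝓝 (extChartAt I x x), P ((extChartAt I x).symm e) :=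
  tendsto_extChartAt_symm x h

theorem eventually_right_inv (x : M) :
    ∀ᶠ e in 𝓝 (extChartAt I x x), extChartAt I x ((extChartAt I x).symm e) = e := by
  filter_upwards [extChartAt_target_mem_nhds (I := I) x] with e he
  exact (extChartAt I x).right_inv he

theorem eventually_eq_comp {F : Type*} {x : M} {f : M → F} {φ : E → F}
    (h : ∀ᶠ y in 𝓝 x, f y = φ (extChartAt I x y)) :
    f ∘ (extChartAt I x).symm =ᶠ[𝓝 (extChartAt I x x)] φ := by
  filter_upwards [eventually_symm h, eventually_right_inv (I := I) x] with e he he'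
  rw [Function.comp_apply, he, he']

theorem mdifferentiableAt_of_eventually_eq {F : Type*} [NormedAddCommGroup F] [NormedSpace ℝ F]
    {x : M} {f : M → F} {φ : E → F} (h : ∀ᶠ y in 𝓝 x, f y = φ (extChartAt I x y))
    (hφ : DifferentiableAt ℝ φ (extChartAt I x x)) : MDifferentiableAt I 𝓘(ℝ, F) f x := by
  refine mdifferentiableAt_iff f x |>.2 ⟨?_, ?_⟩
  · exact (hφ.continuousAt.comp (f := extChartAt I x) (continuousAt_extChartAt x)).congr
      (h.mono fun y hy ↦ hy.symm)
  · rw [I.range_eq_univ, differentiableWithinAt_univ]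
    exact hφ.congr_of_eventuallyEq (eventually_eq_comp h)

/-- Without boundary the range of `I` is the whole space, so the derivative within that range is the
ordinary one. -/
theorem mvfderiv_eq {F : Type*} [NormedAddCommGroup F] [NormedSpace ℝ F]
    {x : M} {f : M → F} {φ : E → F} (h : ∀ᶠ y in 𝓝 x, f y = φ (extChartAt I x y))
    (hφ : DifferentiableAt ℝ φ (extChartAt I x x)) (v : TangentSpace I x) :
    mvfderiv I f x v = fderiv ℝ φ (extChartAt I x x) v := by
  have hf := mdifferentiableAt_of_eventually_eq h hφ
  have : mfderiv I 𝓘(ℝ, F) f x = fderiv ℝ φ (extChartAt I x x) := by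
    rw [hf.mfderiv, I.range_eq_univ, fderivWithin_univ]
    exact (eventually_eq_comp h).fderiv_eq
  exact congrArg (fun L : E →L[ℝ] F ↦ L v) this

theorem differentiableAt_of_mdifferentiableAt {F : Type*} [NormedAddCommGroup F]
    [NormedSpace ℝ F] {x : M} {f : M → F} (hf : MDifferentiableAt I 𝓘(ℝ, F) f x) :
    DifferentiableAt ℝ (f ∘ (extChartAt I x).symm) (extChartAt I x x) := by
  have := (mdifferentiableAt_iff f x |>.1 hf).2
  rw [I.range_eq_univ, differentiableWithinAt_univ] at this
  exact this

/-- The differential of a smooth map in charts. -/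
theorem components_mfderiv {Ψ : M → M'} (hΨ : ContMDiff I I' ∞ Ψ) (x : M) :
    ∀ᶠ y in 𝓝 x, ∀ v : TangentSpace I y, components I' (Ψ x) (Ψ y) (mfderiv I I' Ψ y v) =
      fderiv ℝ (writtenInExtChartAt I I' x Ψ) (extChartAt I x y) (components I x y v) := by
  filter_upwards [eventually_mem_chart_source (H := H) x,
    (hΨ.continuous.tendsto x).eventually (eventually_mem_chart_source (H := H') (Ψ x))]
    with y hy hy' v
  have hd : MDifferentiableAt I I' Ψ y := hΨ.mdifferentiable (by simp) y
  have hd' : MDifferentiableAt I' 𝓘(ℝ, E') (extChartAt I' (Ψ x)) (Ψ y) :=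
    mdifferentiableAt_extChartAt hy'
  have hd0 : MDifferentiableAt I 𝓘(ℝ, E) (extChartAt I x) y := mdifferentiableAt_extChartAt hy
  have hye : (extChartAt I x).symm (extChartAt I x y) = y :=
    (extChartAt I x).left_inv (by simpa using hy)
  have hs : MDifferentiableAt 𝓘(ℝ, E) I (extChartAt I x).symm (extChartAt I x y) := by
    have := mdifferentiableWithinAt_extChartAt_symm (I := I) (x := x) (z := extChartAt I x y)
      ((extChartAt I x).map_source (by simpa using hy))
    rwa [I.range_eq_univ, mdifferentiableWithinAt_univ] at this
  have hF : MDifferentiableAt 𝓘(ℝ, E) 𝓘(ℝ, E') (writtenInExtChartAt I I' x Ψ)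
      (extChartAt I x y) := by
    refine MDifferentiableAt.comp (I' := I') _ ?_ (MDifferentiableAt.comp (I' := I) _ ?_ hs)
    · rw [Function.comp_apply, hye]
      exact hd'
    · rwa [hye]
  -- The two sides of the claim are the derivatives at `y` of these two factorizations of one map,
  -- each computed by the chain rule.
  have hcomp : extChartAt I' (Ψ x) ∘ Ψ =ᶠ[𝓝 y]
      writtenInExtChartAt I I' x Ψ ∘ extChartAt I x := by
    filter_upwards [(chartAt H x).open_source.mem_nhds hy] with z hz
    simp only [writtenInExtChartAt, Function.comp_apply]
    rw [(extChartAt I x).left_inv (by simpa using hz)]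
  rw [components_eq_mfderiv hy', components_eq_mfderiv hy, ← mfderiv_eq_fderiv]
  have h1 := mfderiv_comp y hd' hd
  have h2 := mfderiv_comp y hF hd0
  have h3 := hcomp.mfderiv_eq (I := I) (I' := 𝓘(ℝ, E'))
  rw [h1, h2] at h3
  exact congrArg (fun L : E →L[ℝ] E' ↦ L v) h3

theorem contDiffAt_writtenInExtChartAt {Ψ : M → M'} (hΨ : ContMDiff I I' ∞ Ψ) (x : M) :
    ContDiffAt ℝ ∞ (writtenInExtChartAt I I' x Ψ) (extChartAt I x x) := by
  have := (contMDiffAt_iff.1 (hΨ x)).2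
  rwa [I.range_eq_univ, contDiffWithinAt_univ] at this

end Boundaryless

/-! ### Koszul forms on a normed space -/

section Koszul

variable {F : Type*} [NormedAddCommGroup F] [NormedSpace ℝ F]

/-- A continuous bilinear form with trivial left kernel. -/
def LeftNondegenerate (b : F →L[ℝ] F →L[ℝ] ℝ) : Prop :=
  ∀ a, (∀ z, b a z = 0) → a = 0

theorem LeftNondegenerate.eq {b : F →L[ℝ] F →L[ℝ] ℝ} (hb : LeftNondegenerate b) {a c : F}
    (h : ∀ z, b a z = b c z) : a = c :=
  sub_eq_zero.1 (hb _ fun z ↦ by rw [map_sub, sub_apply, h, sub_self])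

/-- The right-hand side of the Koszul formula, for a metric with derivative `D`. -/
def koszul (D : F →L[ℝ] F →L[ℝ] F →L[ℝ] ℝ) (u w z : F) : ℝ :=
  (D u w z + D w u z - D z u w) / 2

theorem koszul_add_right (D : F →L[ℝ] F →L[ℝ] F →L[ℝ] ℝ) (u w z z' : F) :
    koszul D u w (z + z') = koszul D u w z + koszul D u w z' := by
  simp only [koszul, map_add, add_apply]; ring

theorem koszul_smul_right (D : F →L[ℝ] F →L[ℝ] F →L[ℝ] ℝ) (u w : F) (c : ℝ) (z : F) :
    koszul D u w (c • z) = c * koszul D u w z := by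
  simp only [koszul, map_smul, smul_apply, smul_eq_mul]; ring

theorem koszul_add_middle (D : F →L[ℝ] F →L[ℝ] F →L[ℝ] ℝ) (u w w' z : F) :
    koszul D u (w + w') z = koszul D u w z + koszul D u w' z := by
  simp only [koszul, map_add, add_apply]; ring

/-- A trivial left kernel makes `a ↦ b a` injective into the dual, which has the same dimension,
hence surjective. This supplies the witnesses that the choice-based definitions need. -/
theorem LeftNondegenerate.exists_forall_apply_eq [FiniteDimensional ℝ F]
    {b : F →L[ℝ] F →L[ℝ] ℝ} (hb : LeftNondegenerate b) (α : F →ₗ[ℝ] ℝ) :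
    ∃ a, ∀ z, b a z = α z := by
  let L : F →ₗ[ℝ] Module.Dual ℝ F :=
    { toFun := fun a ↦ (b a : F →ₗ[ℝ] ℝ)
      map_add' := fun a c ↦ by ext; simp
      map_smul' := fun a c ↦ by ext; simp }
  have hL : Function.Injective L := (injective_iff_map_eq_zero L).2 fun a ha ↦
    hb a fun z ↦ LinearMap.congr_fun ha z
  obtain ⟨a, ha⟩ := (LinearMap.injective_iff_surjective_of_finrank_eq_finrank
    (Subspace.dual_finrank_eq (K := ℝ) (V := F)).symm).1 hL α
  exact ⟨a, fun z ↦ LinearMap.congr_fun ha z⟩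

theorem LeftNondegenerate.exists_koszul [FiniteDimensional ℝ F]
    {b : F →L[ℝ] F →L[ℝ] ℝ} (hb : LeftNondegenerate b) (D : F →L[ℝ] F →L[ℝ] F →L[ℝ] ℝ)
    (u w : F) : ∃ a, ∀ z, b a z = koszul D u w z :=
  hb.exists_forall_apply_eq
    { toFun := koszul D u w
      map_add' := koszul_add_right D u w
      map_smul' := koszul_smul_right D u w }

theorem hasFDerivAt_apply₂ {B : F → F →L[ℝ] F →L[ℝ] ℝ} {x : F}
    {D : F →L[ℝ] F →L[ℝ] F →L[ℝ] ℝ} (hB : HasFDerivAt B D x) (v w : F) :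
    HasFDerivAt (fun e ↦ B e v w) ((D.flip v).flip w) x := by
  have := (hB.clm_apply (hasFDerivAt_const v x)).clm_apply (hasFDerivAt_const w x)
  simpa using this

end Koszul

/-! ### Metrics in the preferred charts -/

section Metric

variable [I.Boundaryless] [I'.Boundaryless]

/-- `B` represents `h` near `x` in the preferred chart at `x`, with derivative `D` at `x` and
value `b` at `x`. -/
structure HasCoordMetric (h : MetricField I M) (x : M) (B : E → E →L[ℝ] E →L[ℝ] ℝ)
    (D : E →L[ℝ] E →L[ℝ] E →L[ℝ] ℝ) (b : E →L[ℝ] E →L[ℝ] ℝ) : Prop where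
  hasFDerivAt : HasFDerivAt B D (extChartAt I x x)
  eventually_eq : ∀ᶠ y in 𝓝 x, ∀ v w : TangentSpace I y,
    h y v w = B (extChartAt I x y) (components I x y v) (components I x y w)
  apply_self : ∀ v w : E, h x v w = b v w

/-- The preferred chart at `x` identifies the tangent space at `x` with `E` by the identity, so no
change of components enters at the centre. -/
theorem HasCoordMetric.value_eq {h : MetricField I M} {x : M} {B : E → E →L[ℝ] E →L[ℝ] ℝ}
    {D : E →L[ℝ] E →L[ℝ] E →L[ℝ] ℝ} {b : E →L[ℝ] E →L[ℝ] ℝ} (hB : HasCoordMetric h x B D b) :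
    B (extChartAt I x x) = b := by
  ext v w
  have e : ∀ v : E, (components I x x : E → E) v = v := components_self x
  exact (congrArg₂ (fun a c ↦ B (extChartAt I x x) a c) (e v) (e w)).symm.trans
    ((hB.eventually_eq.self_of_nhds v w).symm.trans (hB.apply_self v w))

theorem HasCoordMetric.mvfderiv_extend {h : MetricField I M} {x : M}
    {B : E → E →L[ℝ] E →L[ℝ] ℝ} {D : E →L[ℝ] E →L[ℝ] E →L[ℝ] ℝ} {b : E →L[ℝ] E →L[ℝ] ℝ}
    (hB : HasCoordMetric h x B D b) (u v w : E) :
    mvfderiv I (fun y ↦ h y (FiberBundle.extend E (x := x) (E := (TangentSpace I : M → Type _)) v y)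
      (FiberBundle.extend E (x := x) (E := (TangentSpace I : M → Type _)) w y)) x u =
      D u v w := by
  have hd := hasFDerivAt_apply₂ hB.hasFDerivAt v w
  refine (mvfderiv_eq (φ := fun e ↦ B e v w) ?_ hd.differentiableAt u).trans ?_
  · filter_upwards [hB.eventually_eq, eventually_mem_chart_source (H := H) x] with y hy hy'
    exact (hy _ _).trans (congrArg₂ (fun a c ↦ B (extChartAt I x y) a c)
      (components_extend hy' v) (components_extend hy' w))
  · exact congrArg (fun L : E →L[ℝ] ℝ ↦ L u) hd.fderiv

/-- The Koszul functional is linear in `z`, so nondegeneracy yields a vector representing it, and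
`Classical.epsilon` then selects such a vector. -/
theorem HasCoordMetric.christoffel_spec [FiniteDimensional ℝ E] {h : MetricField I M} {x : M}
    {B : E → E →L[ℝ] E →L[ℝ] ℝ} {D : E →L[ℝ] E →L[ℝ] E →L[ℝ] ℝ} {b : E →L[ℝ] E →L[ℝ] ℝ}
    (hB : HasCoordMetric h x B D b) (hb : LeftNondegenerate b) (u w z : E) :
    b (christoffel h x u w) z = koszul D u w z := by
  have key : ∀ a z : E, h x a z =
      (mvfderiv I (fun y ↦ h y
          (FiberBundle.extend E (x := x) (E := (TangentSpace I : M → Type _)) w y)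
          (FiberBundle.extend E (x := x) (E := (TangentSpace I : M → Type _)) z y)) x u
        + mvfderiv I (fun y ↦ h y
          (FiberBundle.extend E (x := x) (E := (TangentSpace I : M → Type _)) u y)
          (FiberBundle.extend E (x := x) (E := (TangentSpace I : M → Type _)) z y)) x w
        - mvfderiv I (fun y ↦ h y
          (FiberBundle.extend E (x := x) (E := (TangentSpace I : M → Type _)) u y)
          (FiberBundle.extend E (x := x) (E := (TangentSpace I : M → Type _)) w y)) x z) / 2
      ↔ b a z = koszul D u w z := by
    intro a z
    rw [hB.apply_self, hB.mvfderiv_extend, hB.mvfderiv_extend, hB.mvfderiv_extend]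
    rfl
  obtain ⟨a, ha⟩ := hb.exists_koszul D u w
  exact (key _ z).1 (Classical.epsilon_spec (p := fun a : TangentSpace I x ↦
    ∀ z : TangentSpace I x, h x a z = (mvfderiv I (fun y ↦ h y
          (FiberBundle.extend E (x := x) (E := (TangentSpace I : M → Type _)) w y)
          (FiberBundle.extend E z y)) x u
        + mvfderiv I (fun y ↦ h y
          (FiberBundle.extend E (x := x) (E := (TangentSpace I : M → Type _)) u y)
          (FiberBundle.extend E z y)) x w
        - mvfderiv I (fun y ↦ h y
          (FiberBundle.extend E (x := x) (E := (TangentSpace I : M → Type _)) u y)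
          (FiberBundle.extend E (x := x) (E := (TangentSpace I : M → Type _)) w y)) x z) / 2)
    ⟨a, fun z ↦ (key a z).2 (ha z)⟩ z)

/-- A chosen vector is not additive by construction; additivity follows because nondegeneracy makes
the representing vector unique. -/
theorem HasCoordMetric.christoffel_add [FiniteDimensional ℝ E] {h : MetricField I M} {x : M}
    {B : E → E →L[ℝ] E →L[ℝ] ℝ} {D : E →L[ℝ] E →L[ℝ] E →L[ℝ] ℝ} {b : E →L[ℝ] E →L[ℝ] ℝ}
    (hB : HasCoordMetric h x B D b) (hb : LeftNondegenerate b) (u w w' : TangentSpace I x) :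
    christoffel h x u (w + w') = christoffel h x u w + christoffel h x u w' := by
  have h1 := hB.christoffel_spec hb u
  let Γ : E → E := christoffel h x u
  have hΓ : ∀ w w' : E, Γ (w + w') = Γ w + Γ w' := fun w w' ↦ hb.eq fun z ↦ by
    rw [map_add, add_apply]
    exact (h1 _ z).trans ((koszul_add_middle D u w w' z).trans
      (congrArg₂ _ (h1 w z).symm (h1 w' z).symm))
  exact hΓ w w'

/-! ### Fields along a map in the preferred charts -/

/-- The components of a field along `Ψ`, in the preferred charts at `x` and at `Ψ x`. -/
def fieldComponents (I : ModelWithCorners ℝ E H) {M : Type*} [TopologicalSpace M]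
    [ChartedSpace H M] (Ψ : M → M') (W : Π x : M, TangentSpace I' (Ψ x)) (x : M) (e : E) : E' :=
  components I' (Ψ x) (Ψ ((extChartAt I x).symm e)) (W ((extChartAt I x).symm e))

theorem fieldComponents_spec {Ψ : M → M'} (W : Π x : M, TangentSpace I' (Ψ x)) (x : M) :
    ∀ᶠ y in 𝓝 x, components I' (Ψ x) (Ψ y) (W y) =
      fieldComponents I Ψ W x (extChartAt I x y) := by
  filter_upwards [eventually_mem_chart_source (H := H) x] with y hy
  rw [fieldComponents, (extChartAt I x).left_inv (by simpa using hy)]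

theorem fieldComponents_self {Ψ : M → M'} (W : Π x : M, TangentSpace I' (Ψ x)) (x : M) :
    fieldComponents I Ψ W x (extChartAt I x x) = W x := by
  rw [← (fieldComponents_spec (I := I) W x).self_of_nhds, components_self]

theorem componentDeriv_eq {Ψ : M → M'} {W : Π x : M, TangentSpace I' (Ψ x)} {x : M}
    (hΨ : ContinuousAt Ψ x)
    (hW : DifferentiableAt ℝ (fieldComponents I Ψ W x) (extChartAt I x x))
    (v : TangentSpace I x) :
    componentDeriv Ψ W x v = fderiv ℝ (fieldComponents I Ψ W x) (extChartAt I x x) v := by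
  rw [componentDeriv, mvfderiv_eq (φ := fieldComponents I Ψ W x) ?_ hW]
  · exact symm_self _ _
  · filter_upwards [fieldComponents_spec (I := I) W x,
      hΨ.eventually (eventually_mem_chart_source (H := H') (Ψ x))] with y hy hy'
    rw [← hy, components_apply hy']

theorem IsSmoothFieldAlong.differentiableAt {Ψ : M → M'} {W : Π x : M, TangentSpace I' (Ψ x)}
    (hW : IsSmoothFieldAlong I Ψ W) (hΨ : ContMDiff I I' ∞ Ψ) (x : M) :
    DifferentiableAt ℝ (fieldComponents I Ψ W x) (extChartAt I x x) := by
  have h1 := (contMDiffAt_totalSpace.1 (hW x)).2.mdifferentiableAt (by simp)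
  refine (differentiableAt_of_mdifferentiableAt (I := I) h1).congr_of_eventuallyEq ?_
  filter_upwards [eventually_symm (I := I) ((hΨ.continuous.tendsto x).eventually
    (eventually_mem_chart_source (H := H') (Ψ x)))] with e he
  rw [fieldComponents, components_apply he]
  rfl

/-- Intended for `W = TΨ · W^⊤ + W^⊥`. The differentiability assumptions on both summands are the
reason why the regularity of `W^⊤` has to be proved. -/
theorem inducedConnection_add [FiniteDimensional ℝ E'] {g' : MetricField I' M'} {Ψ : M → M'}
    {x : M} {B : E' → E' →L[ℝ] E' →L[ℝ] ℝ} {D : E' →L[ℝ] E' →L[ℝ] E' →L[ℝ] ℝ}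
    {b : E' →L[ℝ] E' →L[ℝ] ℝ} (hB : HasCoordMetric g' (Ψ x) B D b) (hb : LeftNondegenerate b)
    (hΨ : ContinuousAt Ψ x)
    {W W₁ W₂ : Π x : M, TangentSpace I' (Ψ x)} (hadd : ∀ y, W y = W₁ y + W₂ y)
    (h₁ : DifferentiableAt ℝ (fieldComponents I Ψ W₁ x) (extChartAt I x x))
    (h₂ : DifferentiableAt ℝ (fieldComponents I Ψ W₂ x) (extChartAt I x x))
    (v : TangentSpace I x) :
    inducedConnection g' Ψ W x v
      = inducedConnection g' Ψ W₁ x v + inducedConnection g' Ψ W₂ x v := by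
  have hW : fieldComponents I Ψ W x = fieldComponents I Ψ W₁ x + fieldComponents I Ψ W₂ x := by
    funext e
    simp only [fieldComponents, hadd, map_add, Pi.add_apply]
  have hWd : DifferentiableAt ℝ (fieldComponents I Ψ W x) (extChartAt I x x) := by
    rw [hW]; exact h₁.add h₂
  have e1 : componentDeriv Ψ W x v = componentDeriv Ψ W₁ x v + componentDeriv Ψ W₂ x v := by
    rw [componentDeriv_eq hΨ hWd, componentDeriv_eq hΨ h₁, componentDeriv_eq hΨ h₂, hW,
      fderiv_add h₁ h₂]
    rfl
  rw [inducedConnection, inducedConnection, inducedConnection, e1, hadd, hB.christoffel_add hb]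
  abel

end Metric

/-! ### Pulling back a metric -/

section PullbackCalculus

variable {F F' : Type*} [NormedAddCommGroup F] [NormedSpace ℝ F] [NormedAddCommGroup F']
  [NormedSpace ℝ F']

/-- Composing a bilinear form with a linear map in both arguments amounts to two ordinary
compositions separated by flips, and flipping is continuous linear. -/
theorem differentiableAt_clm_flip {F₁ F₂ F₃ : Type*} [NormedAddCommGroup F₁]
    [NormedSpace ℝ F₁] [NormedAddCommGroup F₂] [NormedSpace ℝ F₂] [NormedAddCommGroup F₃]
    [NormedSpace ℝ F₃] {L : F₁ → F₂ →L[ℝ] F₃ →L[ℝ] ℝ} {x : F₁}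
    (hL : DifferentiableAt ℝ L x) : DifferentiableAt ℝ (fun e ↦ (L e).flip) x := by
  let Φ : (F₂ →L[ℝ] F₃ →L[ℝ] ℝ) →L[ℝ] F₃ →L[ℝ] F₂ →L[ℝ] ℝ :=
    (ContinuousLinearMap.flipₗᵢ ℝ F₂ F₃ ℝ).toContinuousLinearEquiv
  have h := ContinuousLinearMap.differentiableAt (E := F₂ →L[ℝ] F₃ →L[ℝ] ℝ)
    (F := F₃ →L[ℝ] F₂ →L[ℝ] ℝ) Φ (x := L x)
  exact DifferentiableAt.comp (𝕜 := ℝ) (E := F₁) (f := L) (F := F₂ →L[ℝ] F₃ →L[ℝ] ℝ) (G := F₃ →L[ℝ] F₂ →L[ℝ] ℝ)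
    x h hL

/-- The pullback by `f` of a field `B` of bilinear forms. -/
def pullbackForm (f : F → F') (B : F' → F' →L[ℝ] F' →L[ℝ] ℝ) (e : F) : F →L[ℝ] F →L[ℝ] ℝ :=
  (B (f e)).bilinearComp (fderiv ℝ f e) (fderiv ℝ f e)

theorem differentiableAt_pullbackForm {f : F → F'} {B : F' → F' →L[ℝ] F' →L[ℝ] ℝ} {x : F}
    {D : F' →L[ℝ] F' →L[ℝ] F' →L[ℝ] ℝ} (hf : ContDiffAt ℝ ∞ f x) (hB : HasFDerivAt B D (f x)) :
    DifferentiableAt ℝ (pullbackForm f B) x ∧ ∀ u w z,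
      fderiv ℝ (pullbackForm f B) x u w z =
        D (fderiv ℝ f x u) (fderiv ℝ f x w) (fderiv ℝ f x z)
          + B (f x) (fderiv ℝ (fderiv ℝ f) x u w) (fderiv ℝ f x z)
          + B (f x) (fderiv ℝ f x w) (fderiv ℝ (fderiv ℝ f) x u z) := by
  have hd : HasFDerivAt f (fderiv ℝ f x) x := (hf.differentiableAt (by simp)).hasFDerivAt
  have hd2 : HasFDerivAt (fderiv ℝ f) (fderiv ℝ (fderiv ℝ f) x) x :=
    ((hf.fderiv_right (m := 1) (by norm_cast)).differentiableAt (by simp)).hasFDerivAt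
  have hBf : HasFDerivAt (fun e ↦ B (f e)) (D.comp (fderiv ℝ f x)) x :=
    HasFDerivAt.comp (G := F' →L[ℝ] F' →L[ℝ] ℝ) x hB hd
  have hdiff : DifferentiableAt ℝ (pullbackForm f B) x := by
    have h1 : DifferentiableAt ℝ (fun e ↦ (B (f e)).comp (fderiv ℝ f e)) x :=
      hBf.differentiableAt.clm_comp hd2.differentiableAt
    have h2 := differentiableAt_clm_flip h1
    exact differentiableAt_clm_flip (h2.clm_comp hd2.differentiableAt)
  refine ⟨hdiff, fun u w z ↦ ?_⟩
  have h1 := hasFDerivAt_apply₂ hdiff.hasFDerivAt w z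
  have h2 := (hBf.clm_apply (hd2.clm_apply (hasFDerivAt_const w x))).clm_apply
    (hd2.clm_apply (hasFDerivAt_const z x))
  have h3 := congrArg (fun L : F →L[ℝ] ℝ ↦ L u) (h1.unique h2)
  simp only [ContinuousLinearMap.comp_zero, zero_add, ContinuousLinearMap.flip_apply] at h3
  rw [h3]
  simp only [add_apply, ContinuousLinearMap.comp_apply, ContinuousLinearMap.flip_apply]
  ring

/-- The product rule produces six terms containing the second derivative of `f`. By symmetry of that
derivative and of `b`, four cancel in pairs and the remaining two are equal, which absorbs the
factor `1/2`. -/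
theorem koszul_pullbackForm {f : F → F'} {B : F' → F' →L[ℝ] F' →L[ℝ] ℝ} {x : F}
    {D : F' →L[ℝ] F' →L[ℝ] F' →L[ℝ] ℝ} {b : F' →L[ℝ] F' →L[ℝ] ℝ} (hf : ContDiffAt ℝ ∞ f x)
    (hB : HasFDerivAt B D (f x)) (hb : B (f x) = b) (hsymm : ∀ a c, b a c = b c a) (u w z : F) :
    koszul (fderiv ℝ (pullbackForm f B) x) u w z =
      koszul D (fderiv ℝ f x u) (fderiv ℝ f x w) (fderiv ℝ f x z)
        + b (fderiv ℝ (fderiv ℝ f) x u w) (fderiv ℝ f x z) := by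
  have hs : IsSymmSndFDerivAt ℝ f x := hf.isSymmSndFDerivAt (by
    rw [minSmoothness_of_isRCLikeNormedField]; exact ENat.LEInfty.out)
  have h := (differentiableAt_pullbackForm hf hB).2
  rw [koszul, koszul, h, h, h, hb, hs.eq w u, hs.eq z u, hs.eq z w,
    hsymm (fderiv ℝ f x w) (fderiv ℝ (fderiv ℝ f) x u z)]
  ring

end PullbackCalculus

/-! ### The induced metric in charts and the Gauss formula -/

section Gauss

variable [I.Boundaryless] [I'.Boundaryless]

theorem mfderiv_eq_fderiv_written {Ψ : M → M'} (hΨ : ContMDiff I I' ∞ Ψ) (x : M)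
    (v : TangentSpace I x) :
    mfderiv I I' Ψ x v = fderiv ℝ (writtenInExtChartAt I I' x Ψ) (extChartAt I x x) v := by
  have h := (components_mfderiv hΨ x).self_of_nhds v
  rw [components_self] at h
  rw [h]
  exact congrArg _ (components_self x v)

theorem written_self (Ψ : M → M') (x : M) :
    writtenInExtChartAt I I' x Ψ (extChartAt I x x) = extChartAt I' (Ψ x) (Ψ x) := by
  simp [writtenInExtChartAt]

/-- The induced metric in charts. -/
theorem HasCoordMetric.inducedMetric {g' : MetricField I' M'} {Ψ : M → M'}
    (hΨ : ContMDiff I I' ∞ Ψ) {x : M} {B : E' → E' →L[ℝ] E' →L[ℝ] ℝ}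
    {D : E' →L[ℝ] E' →L[ℝ] E' →L[ℝ] ℝ} {b : E' →L[ℝ] E' →L[ℝ] ℝ}
    (hB : HasCoordMetric g' (Ψ x) B D b) :
    HasCoordMetric (inducedMetric I g' Ψ) x (pullbackForm (writtenInExtChartAt I I' x Ψ) B)
      (fderiv ℝ (pullbackForm (writtenInExtChartAt I I' x Ψ) B) (extChartAt I x x))
      (b.bilinearComp (fderiv ℝ (writtenInExtChartAt I I' x Ψ) (extChartAt I x x))
        (fderiv ℝ (writtenInExtChartAt I I' x Ψ) (extChartAt I x x))) := by
  have hB' : HasFDerivAt B D (writtenInExtChartAt I I' x Ψ (extChartAt I x x)) := by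
    rw [written_self]; exact hB.hasFDerivAt
  refine ⟨(differentiableAt_pullbackForm (contDiffAt_writtenInExtChartAt hΨ x) hB').1.hasFDerivAt,
    ?_, fun v w ↦ ?_⟩
  · filter_upwards [components_mfderiv hΨ x, (hΨ.continuous.tendsto x).eventually hB.eventually_eq,
      eventually_mem_chart_source (H := H) x] with y h1 h2 hy v w
    have hw : extChartAt I' (Ψ x) (Ψ y) = writtenInExtChartAt I I' x Ψ (extChartAt I x y) := by
      rw [writtenInExtChartAt, Function.comp_apply, Function.comp_apply,
        (extChartAt I x).left_inv (by simpa using hy)]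
    rw [TractorImmersion.inducedMetric, h2, h1, h1, hw]
    rfl
  · exact (hB.apply_self _ _).trans (congrArg₂ (fun a c ↦ b a c)
      (mfderiv_eq_fderiv_written hΨ x v) (mfderiv_eq_fderiv_written hΨ x w))

theorem fieldComponents_pushField {Ψ : M → M'} (hΨ : ContMDiff I I' ∞ Ψ)
    (U : Π x : M, TangentSpace I x) (x : M) :
    fieldComponents I Ψ (pushField I' Ψ U) x =ᶠ[𝓝 (extChartAt I x x)] fun e ↦
      fderiv ℝ (writtenInExtChartAt I I' x Ψ) e
        (fieldComponents I (fun y : M ↦ y) U x e) := by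
  filter_upwards [eventually_symm (I := I) (components_mfderiv hΨ x),
    eventually_right_inv (I := I) x] with e he he'
  rw [fieldComponents, pushField, he, he']
  rfl

/-- The product rule for `e ↦ f'(e) (U e)`: the term with the second derivative of `f` is the one
that `koszul_pullbackForm` will cancel. -/
theorem differentiableAt_fieldComponents_pushField {Ψ : M → M'} (hΨ : ContMDiff I I' ∞ Ψ)
    {U : Π x : M, TangentSpace I x} {x : M}
    (hU : DifferentiableAt ℝ (fieldComponents I (fun y : M ↦ y) U x) (extChartAt I x x)) :
    DifferentiableAt ℝ (fieldComponents I Ψ (pushField I' Ψ U) x) (extChartAt I x x) ∧ ∀ v : E,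
      fderiv ℝ (fieldComponents I Ψ (pushField I' Ψ U) x) (extChartAt I x x) v =
        fderiv ℝ (fderiv ℝ (writtenInExtChartAt I I' x Ψ)) (extChartAt I x x) v (U x)
        + fderiv ℝ (writtenInExtChartAt I I' x Ψ) (extChartAt I x x)
          (fderiv ℝ (fieldComponents I (fun y : M ↦ y) U x) (extChartAt I x x) v) := by
  have hf := contDiffAt_writtenInExtChartAt hΨ x
  have hd2 := ((hf.fderiv_right (m := 1) (by norm_cast)).differentiableAt (by simp)).hasFDerivAt
  have h := (hd2.clm_apply hU.hasFDerivAt).congr_of_eventuallyEq (fieldComponents_pushField hΨ U x)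
  refine ⟨h.differentiableAt, fun v ↦ ?_⟩
  rw [h.fderiv, add_apply, add_comm]
  refine congrArg₂ _ ?_ rfl
  exact congrArg (fun a : E ↦ fderiv ℝ (fderiv ℝ (writtenInExtChartAt I I' x Ψ))
    (extChartAt I x x) v a) (fieldComponents_self (I := I) (Ψ := fun y : M ↦ y) U x)

/-- The Gauss formula: the tangent part of `∇̃_v (TΨ · U)` is `∇_v U`. -/
theorem gauss_formula [FiniteDimensional ℝ E] [FiniteDimensional ℝ E'] {g' : MetricField I' M'}
    {Ψ : M → M'} (hΨ : ContMDiff I I' ∞ Ψ) {x : M} {B : E' → E' →L[ℝ] E' →L[ℝ] ℝ}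
    {D : E' →L[ℝ] E' →L[ℝ] E' →L[ℝ] ℝ} {b : E' →L[ℝ] E' →L[ℝ] ℝ}
    (hB : HasCoordMetric g' (Ψ x) B D b) (hb : LeftNondegenerate b)
    (hsymm : ∀ a c, b a c = b c a)
    (hind : ∀ a : TangentSpace I x, (∀ z, TractorImmersion.inducedMetric I g' Ψ x a z = 0) → a = 0)
    {U : Π x : M, TangentSpace I x}
    (hU : DifferentiableAt ℝ (fieldComponents I (fun y : M ↦ y) U x) (extChartAt I x x))
    (v z : TangentSpace I x) :
    g' (Ψ x) (inducedConnection g' Ψ (pushField I' Ψ U) x v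
        - mfderiv I I' Ψ x (leviCivita (TractorImmersion.inducedMetric I g' Ψ) U x v))
      (mfderiv I I' Ψ x z) = 0 := by
  have hf := contDiffAt_writtenInExtChartAt hΨ x
  have hB' : HasFDerivAt B D (writtenInExtChartAt I I' x Ψ (extChartAt I x x)) := by
    rw [written_self]; exact hB.hasFDerivAt
  have hbv : B (writtenInExtChartAt I I' x Ψ (extChartAt I x x)) = b := by
    rw [written_self]; exact hB.value_eq
  have hG := hB.inducedMetric hΨ
  have hGn : LeftNondegenerate (b.bilinearComp
      (fderiv ℝ (writtenInExtChartAt I I' x Ψ) (extChartAt I x x))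
      (fderiv ℝ (writtenInExtChartAt I I' x Ψ) (extChartAt I x x))) :=
    fun a ha ↦ hind a fun z ↦ (hG.apply_self a z).trans (ha z)
  have hT : ∀ w : E, mfderiv I I' Ψ x w = _ := mfderiv_eq_fderiv_written hΨ x
  have hpush := differentiableAt_fieldComponents_pushField hΨ hU
  set T : E →L[ℝ] E' := fderiv ℝ (writtenInExtChartAt I I' x Ψ) (extChartAt I x x) with hTdef
  set S : E →L[ℝ] E →L[ℝ] E' :=
    fderiv ℝ (fderiv ℝ (writtenInExtChartAt I I' x Ψ)) (extChartAt I x x) with hSdef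
  set dU : E := fderiv ℝ (fieldComponents I (fun y : M ↦ y) U x) (extChartAt I x x) v with hdU
  let Γ : E := christoffel (TractorImmersion.inducedMetric I g' Ψ) x v (U x)
  let Γ' : E' := christoffel g' (Ψ x) (mfderiv I I' Ψ x v) (mfderiv I I' Ψ x (U x))
  have h1 : (inducedConnection g' Ψ (pushField I' Ψ U) x v : E') = S v (U x) + T dU + Γ' :=
    congrArg₂ (fun a c : E' ↦ a + c)
      ((componentDeriv_eq hΨ.continuous.continuousAt hpush.1 v).trans (hpush.2 v)) rfl
  have h2 : (leviCivita (TractorImmersion.inducedMetric I g' Ψ) U x v : E) = dU + Γ :=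
    congrArg₂ (fun a c : E ↦ a + c)
      (componentDeriv_eq (Ψ := fun y : M ↦ y) continuousAt_id hU v) rfl
  have h3 : b Γ' (T z) = koszul D (T v) (T (U x)) (T z) := by
    refine (hB.christoffel_spec hb _ _ (T z)).trans ?_
    exact congrArg₂ (fun a c : E' ↦ koszul D a c (T z)) (hT v) (hT (U x))
  -- Tested against tangent vectors, `T Γ` equals `Γ'` plus the second derivative term `S v (U x)`.
  -- That same term appears in `h1`, so everything cancels in `h5`.
  have h4 : b (T Γ) (T z) = koszul D (T v) (T (U x)) (T z) + b (S v (U x)) (T z) :=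
    (hG.christoffel_spec hGn v (U x) z).trans (koszul_pullbackForm hf hB' hbv hsymm v (U x) z)
  have h5 : b ((S v (U x) + T dU + Γ') - T (dU + Γ)) (T z) = 0 := by
    rw [map_add, map_sub, map_add, map_add, map_add, sub_apply, add_apply, add_apply, add_apply,
      h3, h4]
    ring
  refine (hB.apply_self _ _).trans (Eq.trans ?_ h5)
  refine congrArg₂ (fun a c : E' ↦ b a c) ?_ (hT z)
  exact congrArg₂ (fun a c : E' ↦ a - c) h1 ((hT _).trans (congrArg T h2))

end Gauss

/-! ### Tangent parts and parallel sections -/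

/-- Invertible continuous linear maps form an open set on which inversion is smooth; this brings
nondegenerate forms within reach of both facts. -/
theorem LeftNondegenerate.exists_equiv {F : Type*} [NormedAddCommGroup F] [NormedSpace ℝ F]
    [FiniteDimensional ℝ F] {b : F →L[ℝ] F →L[ℝ] ℝ} (hb : LeftNondegenerate b) :
    ∃ L : F ≃L[ℝ] (F →L[ℝ] ℝ), (L : F →L[ℝ] F →L[ℝ] ℝ) = b := by
  have hinj : Function.Injective b := fun a c h ↦ hb.eq fun z ↦ by rw [h]
  have hsurj : Function.Surjective b := fun α ↦ by
    obtain ⟨a, ha⟩ := hb.exists_forall_apply_eq (α : F →ₗ[ℝ] ℝ)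
    exact ⟨a, ContinuousLinearMap.ext ha⟩
  exact ⟨(LinearEquiv.ofBijective (b : F →ₗ[ℝ] F →L[ℝ] ℝ) ⟨hinj, hsurj⟩).toContinuousLinearEquiv,
    ContinuousLinearMap.ext fun _ ↦ rfl⟩

section Parallel

variable [I.Boundaryless] [I'.Boundaryless] [FiniteDimensional ℝ E]

/-- Near `x`, the tangent part exists and is obtained by inverting the induced metric in charts. -/
theorem eventually_tangentPart {g' : MetricField I' M'} {Ψ : M → M'} (hΨ : ContMDiff I I' ∞ Ψ)
    {x : M} {B : E' → E' →L[ℝ] E' →L[ℝ] ℝ} {D : E' →L[ℝ] E' →L[ℝ] E' →L[ℝ] ℝ}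
    {b : E' →L[ℝ] E' →L[ℝ] ℝ} (hB : HasCoordMetric g' (Ψ x) B D b)
    (hind : ∀ a : TangentSpace I x, (∀ z, inducedMetric I g' Ψ x a z = 0) → a = 0)
    (W : Π x : M, TangentSpace I' (Ψ x)) :
    ∀ᶠ y in 𝓝 x,
      (∀ v : TangentSpace I y, g' (Ψ y) (W y - mfderiv I I' Ψ y (tangentPart I g' Ψ W y))
        (mfderiv I I' Ψ y v) = 0) ∧
      components I x y (tangentPart I g' Ψ W y) =
        (pullbackForm (writtenInExtChartAt I I' x Ψ) B (extChartAt I x y)).inverse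
          ((B (writtenInExtChartAt I I' x Ψ (extChartAt I x y))
            (fieldComponents I Ψ W x (extChartAt I x y))).comp
            (fderiv ℝ (writtenInExtChartAt I I' x Ψ) (extChartAt I x y))) := by
  have hG := hB.inducedMetric hΨ
  obtain ⟨L, hL⟩ := LeftNondegenerate.exists_equiv (b := pullbackForm
    (writtenInExtChartAt I I' x Ψ) B (extChartAt I x x)) fun a ha ↦ hind a fun z ↦ by
      refine (hG.apply_self a z).trans ?_
      rw [← hG.value_eq]
      exact ha z
  -- Nondegeneracy is assumed only at `x`; it spreads to nearby points because equivalences are open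
  -- and the Gram form is continuous at the chart centre.
  have hinv : ∀ᶠ y in 𝓝 x, pullbackForm (writtenInExtChartAt I I' x Ψ) B (extChartAt I x y) ∈
      Set.range ((↑) : (E ≃L[ℝ] (E →L[ℝ] ℝ)) → E →L[ℝ] E →L[ℝ] ℝ) :=
    ((hG.hasFDerivAt.continuousAt.tendsto.comp (continuousAt_extChartAt x).tendsto).eventually
      (by rw [← hL]; exact ContinuousLinearEquiv.nhds L))
  filter_upwards [hinv, components_mfderiv hΨ x,
    (hΨ.continuous.tendsto x).eventually hB.eventually_eq,
    eventually_mem_chart_source (H := H) x, fieldComponents_spec (I := I) W x]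
    with y ⟨L', hL'⟩ h1 h2 hy h3
  have hw : extChartAt I' (Ψ x) (Ψ y) = writtenInExtChartAt I I' x Ψ (extChartAt I x y) := by
    rw [writtenInExtChartAt, Function.comp_apply, Function.comp_apply,
      (extChartAt I x).left_inv (by simpa using hy)]
  -- In components, orthogonality of `W - TΨ a` to the tangent directions becomes the linear
  -- equation `L' a = α`.
  have key : ∀ a v : TangentSpace I y,
      g' (Ψ y) (W y - mfderiv I I' Ψ y a) (mfderiv I I' Ψ y v) =
        (B (writtenInExtChartAt I I' x Ψ (extChartAt I x y))
          (fieldComponents I Ψ W x (extChartAt I x y))).comp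
            (fderiv ℝ (writtenInExtChartAt I I' x Ψ) (extChartAt I x y)) (components I x y v)
        - L' (components I x y a) (components I x y v) := by
    intro a v
    have h4 : L' (components I x y a) = pullbackForm (writtenInExtChartAt I I' x Ψ) B
      (extChartAt I x y) (components I x y a) := by rw [← hL']; rfl
    rw [h2, map_sub, h1, h1, h3, hw, map_sub, sub_apply, h4]
    rfl
  set α := (B (writtenInExtChartAt I I' x Ψ (extChartAt I x y))
    (fieldComponents I Ψ W x (extChartAt I x y))).comp
      (fderiv ℝ (writtenInExtChartAt I I' x Ψ) (extChartAt I x y))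
  have hex : ∃ a : TangentSpace I y, ∀ v : TangentSpace I y,
      g' (Ψ y) (W y - mfderiv I I' Ψ y a) (mfderiv I I' Ψ y v) = 0 := by
    refine ⟨(trivializationAt E (TangentSpace I : M → Type _) x).symm y (L'.symm α), fun v ↦ ?_⟩
    rw [key, components_symm hy, ContinuousLinearEquiv.apply_symm_apply, sub_self]
  have hspec : ∀ v : TangentSpace I y, g' (Ψ y)
      (W y - mfderiv I I' Ψ y (tangentPart I g' Ψ W y)) (mfderiv I I' Ψ y v) = 0 :=
    Classical.epsilon_spec hex
  refine ⟨hspec, ?_⟩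
  rw [← hL', ContinuousLinearMap.inverse_equiv]
  refine (ContinuousLinearEquiv.eq_symm_apply L').2 (ContinuousLinearMap.ext fun z ↦ ?_)
  have h5 := hspec ((trivializationAt E (TangentSpace I : M → Type _) x).symm y z)
  rw [key, components_symm hy, sub_eq_zero] at h5
  exact h5.symm

/-- A pointwise choice carries no regularity. Near `x`, however, the choice is forced to be the
inverse Gram form applied to a functional built from `W`, and both depend differentiably on the
point. -/
theorem differentiableAt_tangentPart {g' : MetricField I' M'} {Ψ : M → M'}
    (hΨ : ContMDiff I I' ∞ Ψ)
    {x : M} {B : E' → E' →L[ℝ] E' →L[ℝ] ℝ} {D : E' →L[ℝ] E' →L[ℝ] E' →L[ℝ] ℝ}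
    {b : E' →L[ℝ] E' →L[ℝ] ℝ} (hB : HasCoordMetric g' (Ψ x) B D b)
    (hind : ∀ a : TangentSpace I x, (∀ z, inducedMetric I g' Ψ x a z = 0) → a = 0)
    {W : Π x : M, TangentSpace I' (Ψ x)}
    (hW : DifferentiableAt ℝ (fieldComponents I Ψ W x) (extChartAt I x x)) :
    DifferentiableAt ℝ (fieldComponents I (fun y : M ↦ y) (tangentPart I g' Ψ W) x)
      (extChartAt I x x) := by
  have hG := hB.inducedMetric hΨ
  obtain ⟨L, hL⟩ := LeftNondegenerate.exists_equiv (b := pullbackForm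
    (writtenInExtChartAt I I' x Ψ) B (extChartAt I x x)) fun a ha ↦ hind a fun z ↦ by
      refine (hG.apply_self a z).trans ?_
      rw [← hG.value_eq]
      exact ha z
  have hf := contDiffAt_writtenInExtChartAt hΨ x
  have hd := (hf.differentiableAt (by simp)).hasFDerivAt
  have hd2 := (hf.fderiv_right (m := 1) (by norm_cast)).differentiableAt (by simp)
  have hB' : HasFDerivAt B D (writtenInExtChartAt I I' x Ψ (extChartAt I x x)) := by
    rw [written_self]; exact hB.hasFDerivAt
  have hBf : DifferentiableAt ℝ (fun e ↦ B (writtenInExtChartAt I I' x Ψ e)) (extChartAt I x x) :=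
    (HasFDerivAt.comp (G := E' →L[ℝ] E' →L[ℝ] ℝ) _ hB' hd).differentiableAt
  have hα := (hBf.clm_apply hW).clm_comp hd2
  have hinv : DifferentiableAt ℝ (ContinuousLinearMap.inverse : (E →L[ℝ] E →L[ℝ] ℝ) → _)
      (pullbackForm (writtenInExtChartAt I I' x Ψ) B (extChartAt I x x)) := by
    rw [← hL]
    exact (contDiffAt_map_inverse (n := 1) L).differentiableAt (by simp)
  have hi : DifferentiableAt ℝ (fun e ↦
      (pullbackForm (writtenInExtChartAt I I' x Ψ) B e).inverse) (extChartAt I x x) :=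
    DifferentiableAt.comp (𝕜 := ℝ) (E := E) (F := E →L[ℝ] E →L[ℝ] ℝ) (G := (E →L[ℝ] ℝ) →L[ℝ] E)
      (f := pullbackForm (writtenInExtChartAt I I' x Ψ) B) _ hinv hG.hasFDerivAt.differentiableAt
  refine (hi.clm_apply hα).congr_of_eventuallyEq ?_
  filter_upwards [eventually_symm (I := I) (eventually_tangentPart hΨ hB hind W),
    eventually_right_inv (I := I) x] with e he he'
  have h := he.2
  rw [he'] at h
  exact h

/-- No regularity of the field is asked for, because this is applied to covariant derivatives, of
which only the pointwise splitting matters. -/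
theorem tangentPart_spec {g' : MetricField I' M'} {Ψ : M → M'} (hΨ : ContMDiff I I' ∞ Ψ)
    {x : M} {B : E' → E' →L[ℝ] E' →L[ℝ] ℝ} {D : E' →L[ℝ] E' →L[ℝ] E' →L[ℝ] ℝ}
    {b : E' →L[ℝ] E' →L[ℝ] ℝ} (hB : HasCoordMetric g' (Ψ x) B D b)
    (hind : ∀ a : TangentSpace I x, (∀ z, inducedMetric I g' Ψ x a z = 0) → a = 0)
    (W : Π x : M, TangentSpace I' (Ψ x)) (v : TangentSpace I x) :
    b (W x) (mfderiv I I' Ψ x v) = inducedMetric I g' Ψ x (tangentPart I g' Ψ W x) v := by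
  have h := (hB.apply_self _ _).symm.trans
    ((eventually_tangentPart hΨ hB hind W).self_of_nhds.1 v)
  have h2 : b (W x - mfderiv I I' Ψ x (tangentPart I g' Ψ W x)) (mfderiv I I' Ψ x v)
      = b (W x) (mfderiv I I' Ψ x v) - b (mfderiv I I' Ψ x (tangentPart I g' Ψ W x))
        (mfderiv I I' Ψ x v) :=
    congrArg (fun l : E' →L[ℝ] ℝ ↦ l (mfderiv I I' Ψ x v)) (b.map_sub _ _)
  exact (sub_eq_zero.1 (h2.symm.trans h)).trans (hB.apply_self _ _).symm

theorem inducedMetric_add {g' : MetricField I' M'} {Ψ : M → M'} {x : M}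
    {B : E' → E' →L[ℝ] E' →L[ℝ] ℝ} {D : E' →L[ℝ] E' →L[ℝ] E' →L[ℝ] ℝ}
    {b : E' →L[ℝ] E' →L[ℝ] ℝ} (hB : HasCoordMetric g' (Ψ x) B D b) (a c v : TangentSpace I x) :
    inducedMetric I g' Ψ x (a + c) v = inducedMetric I g' Ψ x a v + inducedMetric I g' Ψ x c v := by
  refine (hB.apply_self _ _).trans (Eq.trans ?_
    (congrArg₂ (· + ·) (hB.apply_self _ _) (hB.apply_self _ _)).symm)
  exact congrArg (fun l : E' →L[ℝ] ℝ ↦ l (mfderiv I I' Ψ x v))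
    ((congrArg b (map_add (mfderiv I I' Ψ x) a c)).trans (b.map_add _ _))

theorem eq_of_inducedMetric_eq {g' : MetricField I' M'} {Ψ : M → M'} {x : M}
    {B : E' → E' →L[ℝ] E' →L[ℝ] ℝ} {D : E' →L[ℝ] E' →L[ℝ] E' →L[ℝ] ℝ}
    {b : E' →L[ℝ] E' →L[ℝ] ℝ} (hB : HasCoordMetric g' (Ψ x) B D b)
    (hind : ∀ a : TangentSpace I x, (∀ z, inducedMetric I g' Ψ x a z = 0) → a = 0)
    {a c : TangentSpace I x}
    (h : ∀ v, inducedMetric I g' Ψ x a v = inducedMetric I g' Ψ x c v) : a = c := by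
  refine sub_eq_zero.1 (hind _ fun z ↦ ?_)
  have h1 := inducedMetric_add hB (a - c) c z
  rw [sub_add_cancel, h z] at h1
  linarith

/-- A section along `Ψ` is parallel in the direction of `V` at `x` if and only if its tangent and
normal parts satisfy the Gauss–Weingarten equations there. -/
theorem inducedConnection_eq_zero_iff [FiniteDimensional ℝ E'] {g' : MetricField I' M'}
    {Ψ : M → M'} (hΨ : ContMDiff I I' ∞ Ψ) {x : M} {B : E' → E' →L[ℝ] E' →L[ℝ] ℝ}
    {D : E' →L[ℝ] E' →L[ℝ] E' →L[ℝ] ℝ} {b : E' →L[ℝ] E' →L[ℝ] ℝ}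
    (hB : HasCoordMetric g' (Ψ x) B D b) (hb : LeftNondegenerate b)
    (hsymm : ∀ a c, b a c = b c a)
    (hind : ∀ a : TangentSpace I x, (∀ z, inducedMetric I g' Ψ x a z = 0) → a = 0)
    {W : Π x : M, TangentSpace I' (Ψ x)} (hW : IsSmoothFieldAlong I Ψ W)
    (V : Π x : M, TangentSpace I x) :
    inducedConnection g' Ψ W x (V x) = 0 ↔
      leviCivita (inducedMetric I g' Ψ) (tangentPart I g' Ψ W) x (V x)
          = weingarten g' Ψ (normalPart I g' Ψ W) V x ∧
        secondFundamentalForm g' Ψ V (tangentPart I g' Ψ W) x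
          + normalConnection g' Ψ V (normalPart I g' Ψ W) x = 0 := by
  have hWd := hW.differentiableAt hΨ x
  have hU := differentiableAt_tangentPart hΨ hB hind hWd
  have h₁ := (differentiableAt_fieldComponents_pushField hΨ hU).1
  have h₂ : DifferentiableAt ℝ (fieldComponents I Ψ (normalPart I g' Ψ W) x)
      (extChartAt I x x) := by
    have : fieldComponents I Ψ (normalPart I g' Ψ W) x = fieldComponents I Ψ W x
        - fieldComponents I Ψ (pushField I' Ψ (tangentPart I g' Ψ W)) x := by
      funext e
      simp only [fieldComponents, normalPart, pushField, map_sub, Pi.sub_apply]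
    rw [this]
    exact hWd.sub h₁
  have hadd := inducedConnection_add hB hb hΨ.continuous.continuousAt
    (W := W) (W₁ := pushField I' Ψ (tangentPart I g' Ψ W)) (W₂ := normalPart I g' Ψ W)
    (fun y ↦ by simp only [pushField, normalPart]; abel) h₁ h₂ (V x)
  set X₁ : Π y : M, TangentSpace I' (Ψ y) := fun y ↦
    inducedConnection g' Ψ (pushField I' Ψ (tangentPart I g' Ψ W)) y (V y)
  set X₂ : Π y : M, TangentSpace I' (Ψ y) := fun y ↦
    inducedConnection g' Ψ (normalPart I g' Ψ W) y (V y)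
  have hspec₁ := tangentPart_spec hΨ hB hind X₁
  have hspec₂ := tangentPart_spec hΨ hB hind X₂
  -- By the Gauss formula both vectors have the same inner products with tangent vectors, and the
  -- induced metric separates them.
  have hLC : leviCivita (inducedMetric I g' Ψ) (tangentPart I g' Ψ W) x (V x)
      = tangentPart I g' Ψ X₁ x := by
    refine eq_of_inducedMetric_eq hB hind fun z ↦ ?_
    rw [← hspec₁]
    have h := (hB.apply_self _ _).symm.trans (gauss_formula hΨ hB hb hsymm hind hU (V x) z)
    refine ((hB.apply_self _ _).trans (sub_eq_zero.1 (Eq.trans ?_ h)).symm)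
    exact (congrArg (fun l : E' →L[ℝ] ℝ ↦ l (mfderiv I I' Ψ x z)) (b.map_sub _ _)).symm
  have hsum : X₁ x + X₂ x = 0 → tangentPart I g' Ψ X₁ x + tangentPart I g' Ψ X₂ x = 0 := by
    intro h0
    refine hind _ fun z ↦ ?_
    rw [inducedMetric_add hB, ← hspec₁, ← hspec₂]
    refine (congrArg (fun l : E' →L[ℝ] ℝ ↦ l (mfderiv I I' Ψ x z))
      (b.map_add (X₁ x) (X₂ x))).symm.trans ?_
    refine (congrArg (fun a : E' ↦ b a (mfderiv I I' Ψ x z)) h0).trans ?_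
    exact congrArg (fun l : E' →L[ℝ] ℝ ↦ l (mfderiv I I' Ψ x z)) b.map_zero
  -- The two normal parts add up to the whole derivative minus its tangent part. Once the tangent
  -- parts cancel, the normal equation says precisely that `X₁ x + X₂ x = 0`.
  have hn : secondFundamentalForm g' Ψ V (tangentPart I g' Ψ W) x
        + normalConnection g' Ψ V (normalPart I g' Ψ W) x
      = X₁ x + X₂ x - mfderiv I I' Ψ x (tangentPart I g' Ψ X₁ x + tangentPart I g' Ψ X₂ x) := by
    rw [map_add]
    change (X₁ x - mfderiv I I' Ψ x (tangentPart I g' Ψ X₁ x))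
      + (X₂ x - mfderiv I I' Ψ x (tangentPart I g' Ψ X₂ x)) = _
    abel
  have hw : weingarten g' Ψ (normalPart I g' Ψ W) V x = -tangentPart I g' Ψ X₂ x := rfl
  rw [hadd, hn, hLC, hw, eq_neg_iff_add_eq_zero]
  change X₁ x + X₂ x = 0 ↔ _
  constructor
  · intro h
    refine ⟨hsum h, ?_⟩
    rw [hsum h, h, map_zero, sub_zero]
  · rintro ⟨h, h'⟩
    rwa [h, map_zero, sub_zero] at h'

end Parallel

/-! ### Existence of coordinate representations -/

section Exists

variable [I.Boundaryless] [FiniteDimensional ℝ E]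

/-- The bilinear form with matrix `m` in the standard basis. -/
def formOfMatrix {F : Type*} [NormedAddCommGroup F] [NormedSpace ℝ F] [FiniteDimensional ℝ F]
    (m : Fin (Module.finrank ℝ F) → Fin (Module.finrank ℝ F) → ℝ) : F →L[ℝ] F →L[ℝ] ℝ :=
  ∑ i, ∑ j, m i j • (LinearMap.toContinuousLinearMap ((Module.finBasis ℝ F).coord i)).smulRight
    (LinearMap.toContinuousLinearMap ((Module.finBasis ℝ F).coord j))

theorem formOfMatrix_apply {F : Type*} [NormedAddCommGroup F] [NormedSpace ℝ F]
    [FiniteDimensional ℝ F] (β : F →ₗ[ℝ] F →ₗ[ℝ] ℝ) (v w : F) :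
    formOfMatrix (fun i j ↦ β (Module.finBasis ℝ F i) (Module.finBasis ℝ F j)) v w = β v w := by
  conv_rhs => rw [← (Module.finBasis ℝ F).sum_repr v, ← (Module.finBasis ℝ F).sum_repr w]
  simp only [formOfMatrix, map_sum, map_smul, LinearMap.sum_apply, LinearMap.smul_apply,
    sum_apply, smul_apply, ContinuousLinearMap.smulRight_apply,
    LinearMap.coe_toContinuousLinearMap', Module.Basis.coord_apply, smul_eq_mul, Finset.mul_sum]
  rw [Finset.sum_comm]
  refine Finset.sum_congr rfl fun i _ ↦ Finset.sum_congr rfl fun j _ ↦ ?_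
  ring

theorem differentiableAt_real_smul_const {F G : Type*} [NormedAddCommGroup F] [NormedSpace ℝ F]
    [NormedAddCommGroup G] [NormedSpace ℝ G] {f : F → ℝ} {x : F} (hf : DifferentiableAt ℝ f x)
    (a : G) : DifferentiableAt ℝ (fun e ↦ f e • a) x :=
  hf.smul_const a

/-- By bilinearity the form is determined by its finitely many coefficients on the extended basis,
so differentiability of these scalar functions gives differentiability of the operator-valued map.
-/
theorem exists_hasCoordMetric {h : MetricField I M} {x : M}
    {β : Π y : M, TangentSpace I y →ₗ[ℝ] TangentSpace I y →ₗ[ℝ] ℝ}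
    (hβ : ∀ y v w, h y v w = β y v w)
    (hd : ∀ a c : TangentSpace I x, MDifferentiableAt I 𝓘(ℝ, ℝ)
      (fun y ↦ h y (FiberBundle.extend E a y) (FiberBundle.extend E c y)) x) :
    ∃ B D b, HasCoordMetric h x B D b := by
  let m : Fin (Module.finrank ℝ E) → Fin (Module.finrank ℝ E) → M → ℝ := fun i j y ↦
    h y (FiberBundle.extend E
        (show TangentSpace I x from Module.finBasis ℝ E i) y)
      (FiberBundle.extend E (show TangentSpace I x from Module.finBasis ℝ E j) y)
  let B : E → E →L[ℝ] E →L[ℝ] ℝ := fun e ↦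
    formOfMatrix fun i j ↦ m i j ((extChartAt I x).symm e)
  have hB : DifferentiableAt ℝ B (extChartAt I x x) := by
    refine DifferentiableAt.fun_sum (𝕜 := ℝ) (E := E) (F := E →L[ℝ] E →L[ℝ] ℝ) fun i _ ↦
      DifferentiableAt.fun_sum (𝕜 := ℝ) (E := E) (F := E →L[ℝ] E →L[ℝ] ℝ) fun j _ ↦ ?_
    exact differentiableAt_real_smul_const (G := E →L[ℝ] E →L[ℝ] ℝ)
      (differentiableAt_of_mdifferentiableAt (I := I) (hd _ _)) _
  have hBe : ∀ᶠ y in 𝓝 x, ∀ v w : TangentSpace I y,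
      h y v w = B (extChartAt I x y) (components I x y v) (components I x y w) := by
    filter_upwards [eventually_mem_chart_source (H := H) x] with y hy v w
    let S : E →ₗ[ℝ] TangentSpace I y :=
      ((trivializationAt E (TangentSpace I : M → Type _) x).symmL ℝ y : E →ₗ[ℝ] TangentSpace I y)
    have hS : ∀ u : TangentSpace I y, S (components I x y u) = u := fun u ↦
      components_injective hy ((congrArg _ (Trivialization.symmL_apply _ hy _)).trans
        (components_symm hy _))
    have hE : ∀ a : E, FiberBundle.extend E (show TangentSpace I x from a) y = S a := fun a ↦
      components_injective hy ((components_extend hy _).trans ((congrArg _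
        (Trivialization.symmL_apply _ hy _)).trans (components_symm hy a)).symm)
    have hm : (fun i j ↦ m i j ((extChartAt I x).symm (extChartAt I x y))) = fun i j ↦
        ((β y).compl₁₂ S S) (Module.finBasis ℝ E i) (Module.finBasis ℝ E j) := by
      funext i j
      rw [(extChartAt I x).left_inv (by simpa using hy)]
      simp only [m, hE, hβ]
      rfl
    change _ = formOfMatrix (fun i j ↦ m i j ((extChartAt I x).symm (extChartAt I x y))) _ _
    rw [hm, formOfMatrix_apply, LinearMap.compl₁₂_apply, hS, hS, hβ]
  refine ⟨B, _, B (extChartAt I x x), hB.hasFDerivAt, hBe, fun v w ↦ ?_⟩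
  exact (hBe.self_of_nhds v w).trans (congrArg₂ (fun a c ↦ B (extChartAt I x x) a c)
    (components_self (I := I) x v) (components_self (I := I) x w))

end Exists

/-! ### Smoothness of differentials applied to smooth vector fields -/

section Sections

theorem contMDiffAt_mfderiv_apply {f : M → M'} (hf : ContMDiff I I' ∞ f)
    {s : Π y : M, TangentSpace I y} {x : M}
    (hs : ContMDiffAt I I.tangent ∞ (fun y ↦ (⟨y, s y⟩ : TangentBundle I M)) x) :
    ContMDiffAt I I'.tangent ∞
      (fun y ↦ (⟨f y, mfderiv I I' f y (s y)⟩ : TangentBundle I' M')) x :=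
  (hf.contMDiff_tangentMap (m := ∞) (by simp)).contMDiffAt.comp x hs

theorem contMDiffAt_mvfderiv_apply {f : M → ℝ} (hf : ContMDiff I 𝓘(ℝ, ℝ) ∞ f)
    {s : Π y : M, TangentSpace I y} {x : M}
    (hs : ContMDiffAt I I.tangent ∞ (fun y ↦ (⟨y, s y⟩ : TangentBundle I M)) x) :
    ContMDiffAt I 𝓘(ℝ, ℝ) ∞ (fun y ↦ mvfderiv I f y (s y)) x :=
  (contMDiff_snd_tangentBundle_modelSpace ℝ 𝓘(ℝ, ℝ)).contMDiffAt.comp x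
    (contMDiffAt_mfderiv_apply hf hs)

end Sections

/-! ### The ambient space -/

section Ambient

variable [I.Boundaryless] [FiniteDimensional ℝ E] {δ : ℝ}

theorem contMDiff_ambient_base : ContMDiff (ambientModel I) 𝓘(ℝ, ℝ × ℝ) ∞
    (fun q : Ambient δ M ↦ (q.1 : ℝ × ℝ)) :=
  contMDiff_subtype_val.comp contMDiff_fst

theorem contMDiff_ambient_t : ContMDiff (ambientModel I) 𝓘(ℝ, ℝ) ∞
    (fun q : Ambient δ M ↦ q.1.1.1) :=
  contDiff_fst.contMDiff.comp contMDiff_ambient_base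

theorem contMDiff_ambient_r : ContMDiff (ambientModel I) 𝓘(ℝ, ℝ) ∞
    (fun q : Ambient δ M ↦ q.1.1.2) :=
  contDiff_snd.contMDiff.comp contMDiff_ambient_base

theorem contMDiff_ambient_rt : ContMDiff (ambientModel I) 𝓘(ℝ, ℝ) ∞
    (fun q : Ambient δ M ↦ q.1.1.2 * q.1.1.1) :=
  contMDiff_ambient_r.mul contMDiff_ambient_t

theorem contMDiff_ambient_snd : ContMDiff (ambientModel I) I ∞ (fun q : Ambient δ M ↦ q.2) :=
  contMDiff_snd

/-- The preferred chart of an open subset of a vector space is the inclusion, and a preferred chart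
acts as the identity on the tangent space at its centre. -/
theorem mfderiv_opens_val {F : Type*} [NormedAddCommGroup F] [NormedSpace ℝ F]
    {U : TopologicalSpace.Opens F} (x : U) (v : TangentSpace 𝓘(ℝ, F) x) :
    mfderiv 𝓘(ℝ, F) 𝓘(ℝ, F) (fun y : U ↦ (y : F)) x v = v := by
  have h := components_self (I := 𝓘(ℝ, F)) x v
  rw [components_eq_mfderiv (mem_chart_source F x)] at h
  exact h

theorem mfderiv_ambient_base (p : Ambient δ M) (a : TangentSpace (ambientModel I) p) :
    mfderiv (ambientModel I) 𝓘(ℝ, ℝ × ℝ) (fun q : Ambient δ M ↦ (q.1 : ℝ × ℝ)) p a = a.1 := by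
  have h := mfderiv_comp (I := ambientModel I) (I' := 𝓘(ℝ, ℝ × ℝ)) (I'' := 𝓘(ℝ, ℝ × ℝ)) p
    (g := fun b : ambientBase δ ↦ (b : ℝ × ℝ)) (f := (Prod.fst : Ambient δ M → ambientBase δ))
    ((contMDiff_subtype_val (n := ∞)).mdifferentiable (by simp) _)
    ((contMDiff_fst (n := ∞)).mdifferentiable (by simp) p)
  refine (congrArg (fun L : ((ℝ × ℝ) × E) →L[ℝ] ℝ × ℝ ↦ L a) h).trans ?_
  refine (mfderiv_opens_val _ _).trans ?_
  exact congrArg (fun L : ((ℝ × ℝ) × E) →L[ℝ] ℝ × ℝ ↦ L a) mfderiv_fst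

theorem mvfderiv_ambient_t (p : Ambient δ M) (a : TangentSpace (ambientModel I) p) :
    mvfderiv (ambientModel I) (fun q : Ambient δ M ↦ q.1.1.1) p a = a.1.1 := by
  have h := mfderiv_comp (I := ambientModel I) (I' := 𝓘(ℝ, ℝ × ℝ)) (I'' := 𝓘(ℝ, ℝ)) p
    (g := (Prod.fst : ℝ × ℝ → ℝ)) (f := fun q : Ambient δ M ↦ (q.1 : ℝ × ℝ))
    differentiableAt_fst.mdifferentiableAt
    (contMDiff_ambient_base.mdifferentiable (by simp) p)
  refine (congrArg (fun L : ((ℝ × ℝ) × E) →L[ℝ] ℝ ↦ L a) h).trans ?_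
  rw [mfderiv_eq_fderiv, fderiv_fst]
  exact congrArg Prod.fst (mfderiv_ambient_base p a)

theorem mvfderiv_ambient_r (p : Ambient δ M) (a : TangentSpace (ambientModel I) p) :
    mvfderiv (ambientModel I) (fun q : Ambient δ M ↦ q.1.1.2) p a = a.1.2 := by
  have h := mfderiv_comp (I := ambientModel I) (I' := 𝓘(ℝ, ℝ × ℝ)) (I'' := 𝓘(ℝ, ℝ)) p
    (g := (Prod.snd : ℝ × ℝ → ℝ)) (f := fun q : Ambient δ M ↦ (q.1 : ℝ × ℝ))
    differentiableAt_snd.mdifferentiableAt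
    (contMDiff_ambient_base.mdifferentiable (by simp) p)
  refine (congrArg (fun L : ((ℝ × ℝ) × E) →L[ℝ] ℝ ↦ L a) h).trans ?_
  rw [mfderiv_eq_fderiv, fderiv_snd]
  exact congrArg Prod.snd (mfderiv_ambient_base p a)

theorem mvfderiv_ambient_rt (p : Ambient δ M) (a : TangentSpace (ambientModel I) p) :
    mvfderiv (ambientModel I) (fun q : Ambient δ M ↦ q.1.1.2 * q.1.1.1) p a =
      p.1.1.2 * a.1.1 + p.1.1.1 * a.1.2 := by
  rw [mvfderiv_fun_mul (contMDiff_ambient_r.mdifferentiable (by simp) p)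
    (contMDiff_ambient_t.mdifferentiable (by simp) p), add_apply, smul_apply, smul_apply,
    mvfderiv_ambient_t, mvfderiv_ambient_r]
  rfl

theorem mfderiv_ambient_snd (p : Ambient δ M) (a : TangentSpace (ambientModel I) p) :
    mfderiv (ambientModel I) I (fun q : Ambient δ M ↦ q.2) p a = a.2 :=
  congrArg (fun L : ((ℝ × ℝ) × E) →L[ℝ] E ↦ L a) mfderiv_snd

/-- The ambient metric in terms of the product structure. -/
theorem ambientMetric_apply (g : MetricField I M) (γ : TensorFamily I M) (p : Ambient δ M)
    (a c : TangentSpace (ambientModel I) p) :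
    ambientMetric g γ δ p a c =
      (p.1.1.2 * a.1.1 + p.1.1.1 * a.1.2) * c.1.1 + a.1.1 * (p.1.1.2 * c.1.1 + p.1.1.1 * c.1.2)
        + p.1.1.1 ^ 2 * g p.2 (γ p.1.1.2 p.2 a.2) c.2 := by
  simp only [ambientMetric]
  rw [mvfderiv_ambient_rt, mvfderiv_ambient_rt, mvfderiv_ambient_t, mvfderiv_ambient_t,
    mfderiv_ambient_snd, mfderiv_ambient_snd]

variable (g : ContMDiffRiemannianMetric I ∞ E (TangentSpace I : M → Type _))

/-- The ambient metric as a field of bilinear forms. -/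
def ambientForm (γ : TensorFamily I M) (δ : ℝ) (p : Ambient δ M) :
    TangentSpace (ambientModel I) p →ₗ[ℝ] TangentSpace (ambientModel I) p →ₗ[ℝ] ℝ :=
  LinearMap.mk₂ ℝ (ambientMetric (fun x v w ↦ g.inner x v w) γ δ p)
    (fun a a' c ↦ by simp only [ambientMetric, map_add, add_apply]; ring)
    (fun k a c ↦ by simp only [ambientMetric, map_smul, smul_apply, smul_eq_mul]; ring)
    (fun a c c' ↦ by simp only [ambientMetric, map_add]; ring)
    (fun k a c ↦ by simp only [ambientMetric, map_smul, smul_eq_mul]; ring)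

theorem contMDiffAt_ambientMetric {γ : TensorFamily I M}
    (hγ : IsAdmissible (fun x v w ↦ g.inner x v w) γ δ) {p : Ambient δ M}
    {a c : Π q : Ambient δ M, TangentSpace (ambientModel I) q}
    (ha : ContMDiffAt (ambientModel I) (ambientModel I).tangent ∞
      (fun q ↦ (⟨q, a q⟩ : TangentBundle (ambientModel I) (Ambient δ M))) p)
    (hc : ContMDiffAt (ambientModel I) (ambientModel I).tangent ∞
      (fun q ↦ (⟨q, c q⟩ : TangentBundle (ambientModel I) (Ambient δ M))) p) :
    ContMDiffAt (ambientModel I) 𝓘(ℝ, ℝ) ∞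
      (fun q ↦ ambientMetric (fun x v w ↦ g.inner x v w) γ δ q (a q) (c q)) p := by
  have ha2 := contMDiffAt_mfderiv_apply contMDiff_ambient_snd ha
  have hc2 := contMDiffAt_mfderiv_apply contMDiff_ambient_snd hc
  have hγ' : ContMDiffAt (ambientModel I) (I.prod 𝓘(ℝ, E →L[ℝ] E)) ∞
      (fun q : Ambient δ M ↦ (TotalSpace.mk' (E →L[ℝ] E) q.2 (γ q.1.1.2 q.2) :
        TotalSpace (E →L[ℝ] E) fun x : M ↦ TangentSpace I x →L[ℝ] TangentSpace I x)) p :=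
    hγ.smooth.contMDiffAt.comp p (f := fun q : Ambient δ M ↦ (q.1.1.2, q.2))
      (contMDiff_ambient_r.prodMk contMDiff_ambient_snd).contMDiffAt
  have hγa := ContMDiffAt.clm_bundle_apply hγ' ha2
  have hg : ContMDiffAt (ambientModel I) (I.prod 𝓘(ℝ)) ∞
      (fun q : Ambient δ M ↦ TotalSpace.mk' ℝ (E := Bundle.Trivial M ℝ) q.2
        (g.inner q.2 (γ q.1.1.2 q.2 (mfderiv (ambientModel I) I
          (fun q : Ambient δ M ↦ q.2) q (a q)))
          (mfderiv (ambientModel I) I (fun q : Ambient δ M ↦ q.2) q (c q)))) p := by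
    apply ContMDiffAt.clm_bundle_apply₂ (F₁ := E) (F₂ := E)
    · exact g.contMDiff.contMDiffAt.comp p contMDiff_ambient_snd.contMDiffAt
    · exact hγa
    · exact hc2
  have hg' := (contMDiffAt_totalSpace.1 hg).2
  have ht := (contMDiff_ambient_t (I := I) (δ := δ) (M := M)).contMDiffAt (x := p)
  exact (((contMDiffAt_mvfderiv_apply contMDiff_ambient_rt ha).mul
    (contMDiffAt_mvfderiv_apply contMDiff_ambient_t hc)).add
    ((contMDiffAt_mvfderiv_apply contMDiff_ambient_t ha).mul
    (contMDiffAt_mvfderiv_apply contMDiff_ambient_rt hc))).add ((ht.pow 2).mul hg')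

theorem exists_hasCoordMetric_ambientMetric {γ : TensorFamily I M}
    (hγ : IsAdmissible (fun x v w ↦ g.inner x v w) γ δ) (p : Ambient δ M) :
    ∃ B D b, HasCoordMetric (ambientMetric (fun x v w ↦ g.inner x v w) γ δ) p B D b :=
  exists_hasCoordMetric (β := ambientForm g γ δ) (fun _ _ _ ↦ rfl) fun a c ↦
    (contMDiffAt_ambientMetric g hγ (FiberBundle.contMDiffAt_extend _ _ a)
      (FiberBundle.contMDiffAt_extend _ _ c)).mdifferentiableAt (by simp)

/-- At `r = 0` the differential `d(rt)` reduces to `t dr`, and `γ(0)` is the identity. -/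
theorem ambientMetric_immersion_apply {γ : TensorFamily I M}
    (hγ : IsAdmissible (fun x v w ↦ g.inner x v w) γ δ) (u : M → ℝ) (x : M) (a c : (ℝ × ℝ) × E) :
    ambientMetric (fun x v w ↦ g.inner x v w) γ δ (immersion hγ.pos u x) a c =
      Real.exp (u x) * (a.1.2 * c.1.1 + a.1.1 * c.1.2)
        + Real.exp (u x) ^ 2 * g.inner x a.2 c.2 := by
  have h : γ 0 x a.2 = a.2 := congrArg (fun L : E →L[ℝ] E ↦ L a.2) (hγ.at_zero x)
  have h' : g.inner x (γ 0 x a.2) c.2 = g.inner x a.2 c.2 :=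
    congrArg (fun b : TangentSpace I x ↦ g.inner x b c.2) h
  refine (ambientMetric_apply _ γ _ a c).trans ?_
  change (0 * a.1.1 + Real.exp (u x) * a.1.2) * c.1.1
    + a.1.1 * (0 * c.1.1 + Real.exp (u x) * c.1.2)
    + Real.exp (u x) ^ 2 * g.inner x (γ 0 x a.2) c.2 = _
  linear_combination Real.exp (u x) ^ 2 * h'

/-- Pairing with `∂_r` isolates the `t`-component and pairing with `∂_t` the `r`-component; pairing
with the `M`-component itself uses that `g` is positive definite. -/
theorem ambientMetric_immersion_eq_zero {γ : TensorFamily I M}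
    (hγ : IsAdmissible (fun x v w ↦ g.inner x v w) γ δ) (u : M → ℝ) (x : M) (a : (ℝ × ℝ) × E)
    (h : ∀ c : (ℝ × ℝ) × E,
      ambientMetric (fun x v w ↦ g.inner x v w) γ δ (immersion hγ.pos u x) a c = 0) :
    a = 0 := by
  have hpos := Real.exp_pos (u x)
  have key := fun c ↦ (ambientMetric_immersion_apply g hγ u x a c).symm.trans (h c)
  have h1 : a.1.1 = 0 := by
    have h0 : g.inner x a.2 (0 : E) = 0 := (g.inner x a.2).map_zero
    have := key ((0, 1), 0)
    simp only [mul_zero, mul_one, zero_add] at this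
    have h2 : Real.exp (u x) * a.1.1 = 0 := by linear_combination this - Real.exp (u x) ^ 2 * h0
    exact (mul_eq_zero.1 h2).resolve_left hpos.ne'
  have h2 : a.1.2 = 0 := by
    have h0 : g.inner x a.2 (0 : E) = 0 := (g.inner x a.2).map_zero
    have := key ((1, 0), 0)
    simp only [mul_zero, mul_one, add_zero] at this
    have h2 : Real.exp (u x) * a.1.2 = 0 := by linear_combination this - Real.exp (u x) ^ 2 * h0
    exact (mul_eq_zero.1 h2).resolve_left hpos.ne'
  have h3 : a.2 = 0 := by
    by_contra hne
    have := key (0, a.2)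
    have hg := mul_pos (pow_pos hpos 2) (g.pos x a.2 hne)
    have h4 : Real.exp (u x) ^ 2 * g.inner x a.2 a.2 = 0 := by
      refine Eq.trans ?_ this
      simp
    exact hg.ne' h4
  exact Prod.ext (Prod.ext h1 h2) h3

theorem contMDiff_immersion (hδ : 0 < δ) {u : M → ℝ} (hu : ContMDiff I 𝓘(ℝ, ℝ) ∞ u) :
    ContMDiff I (ambientModel I) ∞ (immersion hδ u) := by
  refine ContMDiff.prodMk ((ContMDiff.subtypeVal_comp_iff _ _).1 ?_) contMDiff_id
  exact (Real.contDiff_exp.contMDiff.comp hu).prodMk_space contMDiff_const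

/-- Since `r` is constant along `Ψ`, the image of `TΨ` has no `∂_r`-component. The `∂_t`-component
created by `u` is null and pairs only with `∂_r`, so just the conformal factor survives. -/
theorem inducedMetric_immersion {γ : TensorFamily I M}
    (hγ : IsAdmissible (fun x v w ↦ g.inner x v w) γ δ) {u : M → ℝ}
    (hu : ContMDiff I 𝓘(ℝ, ℝ) ∞ u) (x : M) (v w : TangentSpace I x) :
    inducedMetric I (ambientMetric (fun x v w ↦ g.inner x v w) γ δ) (immersion hγ.pos u) x v w =
      Real.exp (u x) ^ 2 * g.inner x v w := by
  have hΨ := (contMDiff_immersion hγ.pos hu).mdifferentiable (by simp) x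
  have hr : ∀ v : TangentSpace I x,
      (mfderiv I (ambientModel I) (immersion hγ.pos u) x v : (ℝ × ℝ) × E).1.2 = 0 := by
    intro v
    have h := mfderiv_comp (I' := ambientModel I) (I'' := 𝓘(ℝ, ℝ)) x
      (g := fun q : Ambient δ M ↦ q.1.1.2) (f := immersion hγ.pos u)
      (contMDiff_ambient_r.mdifferentiable (by simp) _) hΨ
    refine (mvfderiv_ambient_r _ _).symm.trans
      ((congrArg (fun L : E →L[ℝ] ℝ ↦ L v) h).symm.trans ?_)
    exact congrArg (fun L : E →L[ℝ] ℝ ↦ L v) (mfderiv_const (c := (0 : ℝ)))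
  have hs : ∀ v : TangentSpace I x,
      (mfderiv I (ambientModel I) (immersion hγ.pos u) x v : (ℝ × ℝ) × E).2 = v := by
    intro v
    have h := mfderiv_comp (I' := ambientModel I) (I'' := I) x
      (g := fun q : Ambient δ M ↦ q.2) (f := immersion hγ.pos u)
      (contMDiff_ambient_snd.mdifferentiable (by simp) _) hΨ
    refine (mfderiv_ambient_snd _ _).symm.trans
      ((congrArg (fun L : E →L[ℝ] E ↦ L v) h).symm.trans ?_)
    exact congrArg (fun L : E →L[ℝ] E ↦ L v) (mfderiv_id (I := I))
  refine (ambientMetric_immersion_apply g hγ u x _ _).trans ?_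
  have h : g.inner x (mfderiv I (ambientModel I) (immersion hγ.pos u) x v : (ℝ × ℝ) × E).2
      (mfderiv I (ambientModel I) (immersion hγ.pos u) x w : (ℝ × ℝ) × E).2 = g.inner x v w :=
    congrArg₂ (fun a c : TangentSpace I x ↦ g.inner x a c) (hs v) (hs w)
  rw [hr v, hr w]
  linear_combination Real.exp (u x) ^ 2 * h

end Ambient

end General

end TractorImmersion

end

/-- Let `Ψ = Ψ^u : M → (M̃, g̃)` and suppose that `γ` is normalized, so that `Ψ^* TM̃`, with the
tractor metric and the tractor connection induced by `g̃` and its Levi-Civita connection, is the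
normal conformal tractor bundle of `(M, [g])`. A section `W` of it is parallel if and only if
`∇_V W^⊤ = A_{W^⊥} V` and `II(V, W^⊤) + ∇^⊥_V W^⊥ = 0` for all vector fields `V` on `M`, where `∇`
is the Levi-Civita connection of the metric that `Ψ` induces on `M`. -/
theorem proposition230212029375 {n : ℕ} (hn : 3 ≤ n)
    {M : Type*} [TopologicalSpace M] [T2Space M] [SecondCountableTopology M]
    [ChartedSpace (EuclideanSpace ℝ (Fin n)) M] [IsManifold (𝓡 n) ∞ M]
    (g : ContMDiffRiemannianMetric (𝓡 n) ∞ (EuclideanSpace ℝ (Fin n))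
      (TangentSpace (𝓡 n) : M → Type _))
    (γ : TractorImmersion.TensorFamily (𝓡 n) M) (δ : ℝ)
    (hγ : TractorImmersion.IsAdmissible (fun x v w ↦ g.inner x v w) γ δ)
    (hnorm : TractorImmersion.IsNormalized (fun x v w ↦ g.inner x v w) γ)
    (u : M → ℝ) (hu : ContMDiff (𝓡 n) 𝓘(ℝ, ℝ) ∞ u)
    (gt : TractorImmersion.MetricField (TractorImmersion.ambientModel (𝓡 n))
      (TractorImmersion.Ambient δ M))
    (hgt : gt = TractorImmersion.ambientMetric (fun x v w ↦ g.inner x v w) γ δ)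
    (Ψ : M → TractorImmersion.Ambient δ M) (hΨ : Ψ = TractorImmersion.immersion hγ.pos u)
    (W : Π x : M, TangentSpace (TractorImmersion.ambientModel (𝓡 n)) (Ψ x))
    (hW : TractorImmersion.IsSmoothFieldAlong (𝓡 n) Ψ W) :
    (∀ V : Π x : M, TangentSpace (𝓡 n) x, TractorImmersion.IsSmoothField V →
        ∀ x : M, TractorImmersion.inducedConnection gt Ψ W x (V x) = 0) ↔
      ∀ V : Π x : M, TangentSpace (𝓡 n) x, TractorImmersion.IsSmoothField V → ∀ x : M,
        TractorImmersion.leviCivita (TractorImmersion.inducedMetric (𝓡 n) gt Ψ)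
            (TractorImmersion.tangentPart (𝓡 n) gt Ψ W) x (V x)
          = TractorImmersion.weingarten gt Ψ (TractorImmersion.normalPart (𝓡 n) gt Ψ W) V x ∧
        TractorImmersion.secondFundamentalForm gt Ψ V
            (TractorImmersion.tangentPart (𝓡 n) gt Ψ W) x
          + TractorImmersion.normalConnection gt Ψ V
            (TractorImmersion.normalPart (𝓡 n) gt Ψ W) x = 0 := by
  subst hgt hΨ
  have hsm := TractorImmersion.contMDiff_immersion hγ.pos hu
  refine forall_congr' fun V ↦ forall_congr' fun _ ↦ forall_congr' fun x ↦ ?_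
  obtain ⟨B, D, b, hB⟩ := TractorImmersion.exists_hasCoordMetric_ambientMetric g hγ
    (TractorImmersion.immersion hγ.pos u x)
  -- The three remaining goals are nondegeneracy and symmetry of the ambient metric at `Ψ x`, and
  -- nondegeneracy of the induced metric, which holds by positivity of `e^{2u} g`.
  refine TractorImmersion.inducedConnection_eq_zero_iff hsm hB (fun a ha ↦ ?_) (fun a c ↦ ?_)
    (fun a ha ↦ ?_) hW V
  · exact TractorImmersion.ambientMetric_immersion_eq_zero g hγ u x a fun c ↦
      (hB.apply_self a c).trans (ha c)
  · rw [← hB.apply_self, ← hB.apply_self]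
    refine (TractorImmersion.ambientMetric_immersion_apply g hγ u x a c).trans
      (Eq.trans ?_ (TractorImmersion.ambientMetric_immersion_apply g hγ u x c a).symm)
    have h := g.symm x a.2 c.2
    linear_combination Real.exp (u x) ^ 2 * h
  · by_contra hne
    have h := (TractorImmersion.inducedMetric_immersion g hγ hu x a a).symm.trans (ha a)
    exact (mul_pos (pow_pos (Real.exp_pos (u x)) 2) (g.pos x a hne)).ne' h
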